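/- Let $p\ge 1$ and let $A\in\mathbb{R}^{p\times p}$, $B\in\mathbb{R}^{p\times q}$, $C\in\mathbb{R}^{m\times p}$, $K\in\mathbb{R}^{q\times p}$, $L\in\mathbb{R}^{p\times m}$ be such that $A+BK$ and $A+LC$ are Schur stable. Suppose that $(A,B)$ is controllable and $(A,C)$ is observable. Then $$k'=\min\{k\ge 0 \mid C(A+BK)^kB\neq 0\}$$ exists and $k'\le p-1$, and the following holds. Consider the closed loop, for $n\ge 0$, $$x_{n+1}=Ax_n+Bu_n+w_n,\qquad u_n=K\hat x_n+e_n,\qquad y_n=Cx_n+z_n+v_n,$$ $$\hat x_{n+1}=A\hat x_n+Bu_n+L(C\hat x_n-y_n),$$ under the attack $$v_n=\alpha(Cx_n+z_n)+C\xi_n+\zeta_n,\qquad \xi_{n+1}=(A+BK)\xi_n+\omega_n,$$ with a fixed $\alpha\in\mathbb{R}$. Here $w_n,z_n,e_n,\omega_n,\zeta_n$ are sequences of zero-mean i.i.d. (jointly, possibly degenerate) Gaussian vectors with covariances $\Sigma_W,\Sigma_Z,\Sigma_E,\Sigma_O,\Sigma_S$ respectively; these five sequences and the random (or deterministic) initial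 triple $(x_0,\hat x_0,\xi_0)$ are mutually independent. Suppose that $\Sigma_E$ has full rank, and let $\Sigma_\Delta$ be the (unique) positive semidefinite solution of $$\Sigma_\Delta=(A+LC)\Sigma_\Delta(A+LC)^{\mathsf T}+\Sigma_W+L\Sigma_ZL^{\mathsf T}.$$ If, almost surely, $$\lim_{N\to\infty}\frac1N\sum_{n=0}^{N-1}(C\hat x_n-y_n)(C\hat x_n-y_n)^{\mathsf T}=C\Sigma_\Delta C^{\mathsf T}+\Sigma_Z \quad\text{and}\quad \lim_{N\to\infty}\frac1N\sum_{n=0}^{N-1}(C\hat x_n-y_n)\,e_{n-k'-1}^{\mathsf T}=0,$$ where $e_j=0$ for $j<0$, then, almost surely, $$\lim_{N\to\infty}\frac1N\sum_{n=0}^{N-1}v_n^{\mathsf T}v_n=0,$$ that is, $v_n$ asymptotically has zero average power. -/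

import Mathlib

open MeasureTheory ProbabilityTheory Filter Topology
open scoped Matrix

namespace Watermark

/-! ### Linear systems -/

/-- The state at time `n` of `x (n+1) = A x n + B u n` started at `x₀`. -/
def stateAt {p q : ℕ} (A : Matrix (Fin p) (Fin p) ℝ) (B : Matrix (Fin p) (Fin q) ℝ)
    (x₀ : Fin p → ℝ) (u : ℕ → Fin q → ℝ) : ℕ → Fin p → ℝ
  | 0 => x₀
  | n + 1 => A *ᵥ stateAt A B x₀ u n + B *ᵥ u n

/-- `(A, B)` is controllable: every state can be steered to every state in finite time. -/
def IsControllable {p q : ℕ} (A : Matrix (Fin p) (Fin p) ℝ) (B : Matrix (Fin p) (Fin q) ℝ) :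
    Prop :=
  ∀ x₀ x₁ : Fin p → ℝ, ∃ (N : ℕ) (u : ℕ → Fin q → ℝ), stateAt A B x₀ u N = x₁

/-- `(A, C)` is observable: the initial state of `x (n+1) = A x n` is determined by the
outputs `C x n`. -/
def IsObservable {p m : ℕ} (A : Matrix (Fin p) (Fin p) ℝ) (C : Matrix (Fin m) (Fin p) ℝ) :
    Prop :=
  ∀ x₀ x₁ : Fin p → ℝ, (∀ n : ℕ, C *ᵥ (A ^ n *ᵥ x₀) = C *ᵥ (A ^ n *ᵥ x₁)) → x₀ = x₁

/-- All complex eigenvalues lie in the open unit disk. -/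
def IsSchurStable {p : ℕ} (F : Matrix (Fin p) (Fin p) ℝ) : Prop :=
  ∀ z ∈ spectrum ℂ (F.map (fun t : ℝ => (t : ℂ))), ‖z‖ < 1

/-- `S` is a positive semidefinite solution of the Lyapunov equation `S = F S Fᵀ + Q`. -/
def IsLyapunovSolution {p : ℕ} (F Q S : Matrix (Fin p) (Fin p) ℝ) : Prop :=
  S.PosSemidef ∧ S = F * S * Fᵀ + Q

/-- The positive semidefinite solution of `S = F S Fᵀ + Q`. It exists and is unique when `F` is
Schur stable and `Q` is positive semidefinite, see `existsUnique_lyapunov`. -/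
noncomputable def lyapunovSolution {p : ℕ} (F Q : Matrix (Fin p) (Fin p) ℝ) :
    Matrix (Fin p) (Fin p) ℝ :=
  Classical.epsilon (IsLyapunovSolution F Q)

section Lyapunov

attribute [local instance] Matrix.frobeniusNormedAddCommGroup Matrix.frobeniusNormedSpace
  Matrix.frobeniusNormedRing Matrix.frobeniusNormedAlgebra

theorem exists_norm_pow_le {p : ℕ} {F : Matrix (Fin p) (Fin p) ℝ} (hF : IsSchurStable F) :
    ∃ r : ℝ, 0 ≤ r ∧ r < 1 ∧ ∀ᶠ k : ℕ in atTop, ‖F ^ k‖ ≤ r ^ k := by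
  rcases Nat.eq_zero_or_pos p with rfl | hp
  · refine ⟨0, le_rfl, one_pos, Eventually.of_forall fun k => ?_⟩
    have : F ^ k = 0 := Subsingleton.elim _ _
    rw [this, norm_zero]
    positivity
  · have : Nonempty (Fin p) := ⟨⟨0, hp⟩⟩
    set G : Matrix (Fin p) (Fin p) ℂ := F.map (fun t : ℝ => (t : ℂ)) with hG
    have : CompleteSpace (Matrix (Fin p) (Fin p) ℂ) := FiniteDimensional.complete ℂ _
    have hρ : spectralRadius ℂ G < ((1 : NNReal) : ENNReal) :=
      spectrum.spectralRadius_lt_of_forall_lt G fun z hz => by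
        exact_mod_cast hF z hz
    obtain ⟨r, hr1, hr2⟩ := ENNReal.lt_iff_exists_nnreal_btwn.1 hρ
    have hev := (spectrum.pow_nnnorm_pow_one_div_tendsto_nhds_spectralRadius G).eventually
      (gt_mem_nhds hr1)
    refine ⟨r, r.2, by exact_mod_cast hr2, ?_⟩
    filter_upwards [hev, eventually_gt_atTop 0] with k hk hk0
    have hk' : ((‖G ^ k‖₊ : ENNReal)) ≤ (r : ENNReal) ^ k := by
      have h := ENNReal.rpow_le_rpow hk.le (Nat.cast_nonneg k : (0 : ℝ) ≤ k)
      rwa [← ENNReal.rpow_mul, one_div_mul_cancel (by positivity), ENNReal.rpow_one,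
        ENNReal.rpow_natCast] at h
    have hmap : G ^ k = (F ^ k).map (fun t : ℝ => (t : ℂ)) :=
      ((Complex.ofRealHom.mapMatrix).map_pow F k).symm
    have hn : ‖G ^ k‖ = ‖F ^ k‖ := by
      rw [hmap]
      exact Matrix.frobenius_norm_map_eq _ _ fun a => Complex.norm_real a
    rw [← hn]
    exact_mod_cast hk'

theorem summable_lyapunov {p : ℕ} {F : Matrix (Fin p) (Fin p) ℝ} (hF : IsSchurStable F)
    (Q : Matrix (Fin p) (Fin p) ℝ) : Summable fun k : ℕ => F ^ k * Q * (F ^ k)ᵀ := by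
  have : CompleteSpace (Matrix (Fin p) (Fin p) ℝ) := FiniteDimensional.complete ℝ _
  obtain ⟨r, hr0, hr1, hr⟩ := exists_norm_pow_le hF
  have hs : Summable fun k : ℕ => ‖Q‖ * (r ^ 2) ^ k :=
    (summable_geometric_of_lt_one (by positivity) (by nlinarith)).mul_left _
  refine Summable.of_norm_bounded_eventually_nat hs ?_
  filter_upwards [hr] with k hk
  calc ‖F ^ k * Q * (F ^ k)ᵀ‖ ≤ ‖F ^ k‖ * ‖Q‖ * ‖(F ^ k)ᵀ‖ :=
        (norm_mul_le _ _).trans (by gcongr; exact norm_mul_le _ _)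
    _ = ‖F ^ k‖ * ‖Q‖ * ‖F ^ k‖ := by rw [Matrix.frobenius_norm_transpose]
    _ ≤ r ^ k * ‖Q‖ * r ^ k := by gcongr
    _ = ‖Q‖ * (r ^ 2) ^ k := by ring

theorem existsUnique_lyapunov {p : ℕ} {F Q : Matrix (Fin p) (Fin p) ℝ} (hF : IsSchurStable F)
    (hQ : Q.PosSemidef) : ∃! S, IsLyapunovSolution F Q S := by
  have hs := summable_lyapunov hF Q
  refine ⟨∑' k : ℕ, F ^ k * Q * (F ^ k)ᵀ, ⟨?_, ?_⟩, ?_⟩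
  · have hterm : ∀ k : ℕ, (F ^ k * Q * (F ^ k)ᵀ).PosSemidef := fun k => by
      simpa using hQ.mul_mul_conjTranspose_same (F ^ k)
    refine Matrix.posSemidef_iff_dotProduct_mulVec.2 ⟨?_, fun x => ?_⟩
    · rw [Matrix.IsHermitian, Matrix.conjTranspose_tsum]
      exact tsum_congr fun k => (hterm k).1
    · have hc : Continuous fun M : Matrix (Fin p) (Fin p) ℝ => star x ⬝ᵥ (M *ᵥ x) := by
        fun_prop
      have hlim := (hc.tendsto _).comp hs.hasSum
      refine ge_of_tendsto' hlim fun s => ?_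
      exact (Matrix.posSemidef_iff_dotProduct_mulVec.1
        (Matrix.posSemidef_sum s fun k _ => hterm k)).2 x
  · have h1 := hs.tsum_eq_zero_add
    have h2 : ∑' k : ℕ, F ^ (k + 1) * Q * (F ^ (k + 1))ᵀ
        = F * (∑' k : ℕ, F ^ k * Q * (F ^ k)ᵀ) * Fᵀ := by
      rw [← hs.tsum_mul_left, ← (hs.mul_left F).tsum_mul_right]
      refine tsum_congr fun k => ?_
      rw [pow_succ', Matrix.transpose_mul]
      noncomm_ring
    rw [h2] at h1
    conv_lhs => rw [h1]
    simp [add_comm]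
  · intro S hS
    have hrep : ∀ n : ℕ, S = F ^ n * S * (F ^ n)ᵀ
        + ∑ k ∈ Finset.range n, F ^ k * Q * (F ^ k)ᵀ := by
      intro n
      induction n with
      | zero => simp
      | succ n ih =>
        rw [Finset.sum_range_succ, pow_succ, Matrix.transpose_mul]
        conv_lhs => rw [ih]
        conv_lhs => rw [hS.2]
        noncomm_ring
    have h0 := (summable_lyapunov hF S).tendsto_atTop_zero
    have h1 := h0.add hs.hasSum.tendsto_sum_nat
    rw [zero_add] at h1
    refine tendsto_nhds_unique (tendsto_const_nhds (x := S)) (h1.congr fun n => (hrep n).symm)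

end Lyapunov

/-- `lyapunovSolution` is the solution of the Lyapunov equation. -/
theorem lyapunovSolution_spec {p : ℕ} {F Q : Matrix (Fin p) (Fin p) ℝ} (hF : IsSchurStable F)
    (hQ : Q.PosSemidef) : IsLyapunovSolution F Q (lyapunovSolution F Q) :=
  Classical.epsilon_spec (existsUnique_lyapunov hF hQ).exists

/-! ### Random inputs -/

/-- The random inputs: initial plant state `x₀`, initial observer state `xhat₀`, initial false
state `ξ₀` of the attacker, process noise `w`, measurement noise `z`, private excitation `e`,
and the attacker's noises `o` (driving the false state) and `ζ` (added to the false output). -/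
structure Inputs (p q m : ℕ) (Ω : Type*) where
  x₀ : Ω → Fin p → ℝ
  xhat₀ : Ω → Fin p → ℝ
  ξ₀ : Ω → Fin p → ℝ
  w : ℕ → Ω → Fin p → ℝ
  z : ℕ → Ω → Fin m → ℝ
  e : ℕ → Ω → Fin q → ℝ
  o : ℕ → Ω → Fin p → ℝ
  ζ : ℕ → Ω → Fin m → ℝ

/-- Index set of the independent sources of randomness. -/
inductive Source : Type
  | start : Source
  | w : ℕ → Source
  | z : ℕ → Source
  | e : ℕ → Source
  | o : ℕ → Source
  | ζ : ℕ → Source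

/-- The space in which a source takes its values. -/
abbrev Source.Val (p q m : ℕ) : Source → Type
  | .start => (Fin p → ℝ) × (Fin p → ℝ) × (Fin p → ℝ)
  | .w _ => Fin p → ℝ
  | .z _ => Fin m → ℝ
  | .e _ => Fin q → ℝ
  | .o _ => Fin p → ℝ
  | .ζ _ => Fin m → ℝ

instance (p q m : ℕ) : (s : Source) → MeasurableSpace (s.Val p q m)
  | .start => inferInstanceAs (MeasurableSpace ((Fin p → ℝ) × (Fin p → ℝ) × (Fin p → ℝ)))
  | .w _ => inferInstanceAs (MeasurableSpace (Fin p → ℝ))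
  | .z _ => inferInstanceAs (MeasurableSpace (Fin m → ℝ))
  | .e _ => inferInstanceAs (MeasurableSpace (Fin q → ℝ))
  | .o _ => inferInstanceAs (MeasurableSpace (Fin p → ℝ))
  | .ζ _ => inferInstanceAs (MeasurableSpace (Fin m → ℝ))

/-- The random variable belonging to each source. The three initial states are one source, so
they may depend on each other. -/
def Inputs.source {p q m : ℕ} {Ω : Type*} (η : Inputs p q m Ω) :
    (s : Source) → Ω → s.Val p q m
  | .start => fun t => (η.x₀ t, η.xhat₀ t, η.ξ₀ t)
  | .w n => η.w n
  | .z n => η.z n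
  | .e n => η.e n
  | .o n => η.o n
  | .ζ n => η.ζ n

/-- `X` is jointly Gaussian with mean zero and covariance matrix `S` (possibly degenerate). -/
structure IsCenteredGaussian {Ω : Type*} [MeasurableSpace Ω] (μ : Measure Ω) {d : ℕ}
    (X : Ω → Fin d → ℝ) (S : Matrix (Fin d) (Fin d) ℝ) : Prop where
  gaussian : HasGaussianLaw X μ
  mean : ∀ i, ∫ t, X t i ∂μ = 0
  covariance : ∀ i j, ∫ t, X t i * X t j ∂μ = S i j

/-- All sources are independent, and each noise is Gaussian with mean zero and the given constant
covariance (so each noise sequence is i.i.d.). -/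
structure Inputs.IsAdmissible {p q m : ℕ} {Ω : Type*} [MeasurableSpace Ω] (μ : Measure Ω)
    (η : Inputs p q m Ω) (SW : Matrix (Fin p) (Fin p) ℝ) (SZ : Matrix (Fin m) (Fin m) ℝ)
    (SE : Matrix (Fin q) (Fin q) ℝ) (SO : Matrix (Fin p) (Fin p) ℝ)
    (SS : Matrix (Fin m) (Fin m) ℝ) : Prop where
  measurable : ∀ s, Measurable (η.source s)
  indep : iIndepFun η.source μ
  w_law : ∀ n, IsCenteredGaussian μ (η.w n) SW
  z_law : ∀ n, IsCenteredGaussian μ (η.z n) SZ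
  e_law : ∀ n, IsCenteredGaussian μ (η.e n) SE
  o_law : ∀ n, IsCenteredGaussian μ (η.o n) SO
  ζ_law : ∀ n, IsCenteredGaussian μ (η.ζ n) SS

/-! ### The closed loop under attack -/

/-- Plant matrices `A, B, C`, feedback gain `K`, observer gain `L`. -/
structure Plant (p q m : ℕ) where
  A : Matrix (Fin p) (Fin p) ℝ
  B : Matrix (Fin p) (Fin q) ℝ
  C : Matrix (Fin m) (Fin p) ℝ
  K : Matrix (Fin q) (Fin p) ℝ
  L : Matrix (Fin p) (Fin m) ℝ

/-- Joint state: plant state `x`, observer state `xhat`, false state `ξ`. -/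
structure LoopState (p : ℕ) where
  x : Fin p → ℝ
  xhat : Fin p → ℝ
  ξ : Fin p → ℝ

variable {p q m : ℕ} {Ω : Type*}

/-- The attack `v = α (C x + z) + C ξ + ζ`, given the joint state and the values of `z`, `ζ`. -/
def Plant.attackOf (P : Plant p q m) (α : ℝ) (s : LoopState p) (z ζ : Fin m → ℝ) : Fin m → ℝ :=
  α • (P.C *ᵥ s.x + z) + P.C *ᵥ s.ξ + ζ

/-- The received measurement `y = C x + z + v`. -/
def Plant.outputOf (P : Plant p q m) (α : ℝ) (s : LoopState p) (z ζ : Fin m → ℝ) : Fin m → ℝ :=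
  P.C *ᵥ s.x + z + P.attackOf α s z ζ

/-- The closed loop: with `u = K xhat + e`, the plant is `x⁺ = A x + B u + w`, the observer is
`xhat⁺ = A xhat + B u + L (C xhat - y)`, and the false state is `ξ⁺ = (A + B K) ξ + o`. -/
def Plant.loop (P : Plant p q m) (α : ℝ) (η : Inputs p q m Ω) (t : Ω) : ℕ → LoopState p
  | 0 => ⟨η.x₀ t, η.xhat₀ t, η.ξ₀ t⟩
  | n + 1 =>
    let s := P.loop α η t n
    let u := P.K *ᵥ s.xhat + η.e n t
    let y := P.outputOf α s (η.z n t) (η.ζ n t)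
    { x := P.A *ᵥ s.x + P.B *ᵥ u + η.w n t
      xhat := P.A *ᵥ s.xhat + P.B *ᵥ u + P.L *ᵥ (P.C *ᵥ s.xhat - y)
      ξ := (P.A + P.B * P.K) *ᵥ s.ξ + η.o n t }

/-- The attack signal `v n`. -/
def Plant.attack (P : Plant p q m) (α : ℝ) (η : Inputs p q m Ω) (n : ℕ) (t : Ω) : Fin m → ℝ :=
  P.attackOf α (P.loop α η t n) (η.z n t) (η.ζ n t)

/-- The residual `C xhat n - y n`. -/
def Plant.residual (P : Plant p q m) (α : ℝ) (η : Inputs p q m Ω) (n : ℕ) (t : Ω) :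
    Fin m → ℝ :=
  P.C *ᵥ (P.loop α η t n).xhat - P.outputOf α (P.loop α η t n) (η.z n t) (η.ζ n t)

/-- The excitation `d` steps earlier, `e (n - d)`, with value `0` at negative times. -/
def Inputs.delayedExcitation (η : Inputs p q m Ω) (d n : ℕ) (t : Ω) : Fin q → ℝ :=
  if d ≤ n then η.e (n - d) t else 0

/-- `(1/N) ∑_{n < N} f n → l` almost surely as `N → ∞`. -/
def AvgTendsto [MeasurableSpace Ω] (μ : Measure Ω) {M : Type*} [AddCommGroup M] [Module ℝ M]
    [TopologicalSpace M] (f : ℕ → Ω → M) (l : M) : Prop :=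
  ∀ᵐ t ∂μ, Tendsto (fun N : ℕ => (1 / (N : ℝ)) • ∑ n ∈ Finset.range N, f n t) atTop (𝓝 l)

/-- The steady-state covariance of the observation error without attack. -/
noncomputable def Plant.errorCov (P : Plant p q m) (SW : Matrix (Fin p) (Fin p) ℝ)
    (SZ : Matrix (Fin m) (Fin m) ℝ) : Matrix (Fin p) (Fin p) ℝ :=
  lyapunovSolution (P.A + P.L * P.C) (SW + P.L * SZ * P.Lᵀ)

/-- The pair of asymptotic tests with delay `k'`. -/
def Plant.PassesTests [MeasurableSpace Ω] (P : Plant p q m) (μ : Measure Ω) (α : ℝ)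
    (η : Inputs p q m Ω) (SW : Matrix (Fin p) (Fin p) ℝ) (SZ : Matrix (Fin m) (Fin m) ℝ)
    (k' : ℕ) : Prop :=
  AvgTendsto μ (fun n t => Matrix.vecMulVec (P.residual α η n t) (P.residual α η n t))
      (P.C * P.errorCov SW SZ * P.Cᵀ + SZ) ∧
    AvgTendsto μ (fun n t => Matrix.vecMulVec (P.residual α η n t)
      (η.delayedExcitation (k' + 1) n t)) (0 : Matrix (Fin m) (Fin q) ℝ)

end Watermark

/-! Write F = A + BK. The relative degree k' exists because feedback does not change the reachable
states: if C F^k B = 0 for all k < p, Cayley–Hamilton gives it for all k, so C kills every reachable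
state. By controllability C = 0, contrary to observability (`exists_markov_ne_zero`).

Multiplicative part. The observation error xhat - x feels the excitation only through the attack.
Hence e_J first reaches the residual at time J + k' + 1, and there it appears as -α C F^k' B e_J
plus a term free of e_J, e_{J+1}, ... (`Plant.residual_truncate`). A law of large numbers for
martingale differences makes that term asymptotically uncorrelated with e_J, so the second test
forces α C F^k' B Σ_E = 0, hence α = 0 (`Plant.PassesTests.gain_eq_zero`).

Additive part. For α = 0 the pair (observation error, ξ) is a stable linear system driven by white
noise. Its empirical covariance converges to the stationary covariance, which is additive in the
noise covariance (`IsStable.avgCov`, `stationaryCov_add`). Subtracting the nominal contribution, the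
first test says that a sum of two positive semidefinite matrices is zero: Σ_S, and the residual
covariance caused by the attacker's noises. So Σ_S = 0, and then the response at every delay
vanishes. By induction on the delay this means C F^k Σ_O = 0 for all k, so the attack itself has
zero covariance (`Plant.attackCov_eq_zero`). -/

namespace Watermark

/-! ### Averages of real sequences -/

/-- Kronecker's lemma with weights `n + 1`. -/
theorem tendsto_avg_of_tendsto_sum_div {x : ℕ → ℝ} {l : ℝ}
    (h : Tendsto (fun N : ℕ => ∑ n ∈ Finset.range N, x n / (n + 1)) atTop (𝓝 l)) :
    Tendsto (fun N : ℕ => (1 / (N : ℝ)) * ∑ n ∈ Finset.range N, x n) atTop (𝓝 0) := by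
  set S : ℕ → ℝ := fun N => ∑ n ∈ Finset.range N, x n / (n + 1) with hS
  have hsum : ∀ N : ℕ, ∑ n ∈ Finset.range N, x n = N * S N - ∑ n ∈ Finset.range N, S n := by
    intro N
    induction N with
    | zero => simp
    | succ N ih =>
      have h1 : S (N + 1) = S N + x N / (N + 1) := Finset.sum_range_succ _ _
      have h2 : (N : ℝ) + 1 ≠ 0 := by positivity
      rw [Finset.sum_range_succ, ih, Finset.sum_range_succ, h1]
      push_cast
      field_simp
      ring
  -- By the summation by parts above, the average of `x` is `S N` minus the Cesàro mean of `S`; both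
  -- tend to `l`.
  have h1 := h.sub h.cesaro
  rw [sub_self] at h1
  refine h1.congr' ?_
  filter_upwards [eventually_gt_atTop 0] with N hN
  have : (N : ℝ) ≠ 0 := by positivity
  rw [hsum N]
  field_simp

/-- If the averages of squares are bounded then `∑ s n ^ 2 / (n + 1) ^ 2` is bounded. -/
theorem sum_sq_div_sq_le {s : ℕ → ℝ} {c : ℝ}
    (h : ∀ N : ℕ, ∑ n ∈ Finset.range N, s n ^ 2 ≤ c * N) (N : ℕ) :
    ∑ n ∈ Finset.range N, (s n / (n + 1)) ^ 2 ≤ 2 * c := by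
  have hc : 0 ≤ c := by simpa using (sq_nonneg (s 0)).trans (by simpa using h 1)
  -- Summation by parts in inductive form: the boundary term T / (N + 1)² and the telescoping 1 -
  -- 1/(N + 1) are what make the induction close.
  have key : ∀ N : ℕ, ∑ n ∈ Finset.range N, (s n / (n + 1)) ^ 2
      ≤ (∑ n ∈ Finset.range N, s n ^ 2) / (N + 1) ^ 2 + 2 * c * (1 - 1 / (N + 1)) := by
    intro N
    induction N with
    | zero => simp
    | succ N ih =>
      have hT := h (N + 1)
      rw [Finset.sum_range_succ] at hT ⊢
      rw [Finset.sum_range_succ]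
      set T := ∑ n ∈ Finset.range N, s n ^ 2
      push_cast at hT ⊢
      have hx : (0 : ℝ) < N + 1 := by positivity
      have hy : (0 : ℝ) < N + 1 + 1 := by positivity
      have h1 : (T + s N ^ 2) / (N + 1 : ℝ) ^ 2 - (T + s N ^ 2) / (N + 1 + 1 : ℝ) ^ 2
          ≤ 2 * c * (1 / (N + 1) - 1 / (N + 1 + 1)) := by
        have e1 : (T + s N ^ 2) / (N + 1 : ℝ) ^ 2 - (T + s N ^ 2) / (N + 1 + 1 : ℝ) ^ 2
            = (T + s N ^ 2) * ((2 * N + 3) / ((N + 1) ^ 2 * (N + 1 + 1) ^ 2)) := by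
          field_simp
          ring
        have e2 : 2 * c * (1 / (N + 1 : ℝ) - 1 / (N + 1 + 1))
            = c * (N + 1) * ((2 * N + 4) / ((N + 1) ^ 2 * (N + 1 + 1) ^ 2)) := by
          field_simp
          ring
        rw [e1, e2]
        refine mul_le_mul hT ?_ (by positivity) (by positivity)
        gcongr
        norm_num
      have h2 : (s N / (N + 1 : ℝ)) ^ 2 = (T + s N ^ 2) / (N + 1 : ℝ) ^ 2 - T / (N + 1 : ℝ) ^ 2 := by
        rw [div_pow]; ring
      rw [h2]
      linarith
  refine (key N).trans ?_
  have h3 : (∑ n ∈ Finset.range N, s n ^ 2) / ((N : ℝ) + 1) ^ 2 ≤ 2 * c * (1 / (N + 1)) := by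
    rw [div_le_iff₀ (by positivity)]
    have : 2 * c * (1 / ((N : ℝ) + 1)) * (N + 1) ^ 2 = 2 * c * (N + 1) := by
      field_simp
    rw [this]
    nlinarith [h N, (Nat.cast_nonneg N : (0 : ℝ) ≤ N)]
  linarith

/-- Bounded averages of squares propagate through a scalar contraction. -/
theorem sum_sq_le_of_contraction {a b : ℕ → ℝ} {r : ℝ} (hr0 : 0 ≤ r) (hr1 : r < 1)
    (ha : ∀ n, 0 ≤ a n) (hab : ∀ n, a (n + 1) ≤ r * a n + b n)
    (hb : ∃ d, ∀ N : ℕ, ∑ n ∈ Finset.range N, b n ^ 2 ≤ d * N) :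
    ∃ d, ∀ N : ℕ, ∑ n ∈ Finset.range N, a n ^ 2 ≤ d * N := by
  obtain ⟨d, hd⟩ := hb
  have h1r : 0 < 1 - r := by linarith
  -- Convexity of the square at the combination r · a + (1 - r) · (b / (1 - r)).
  have hstep : ∀ n, a (n + 1) ^ 2 ≤ r * a n ^ 2 + b n ^ 2 / (1 - r) := by
    intro n
    have h1 : a (n + 1) ^ 2 ≤ (r * a n + b n) ^ 2 := by
      have := ha (n + 1)
      have := hab n
      gcongr
    refine h1.trans ?_
    have h2 : r * a n ^ 2 + b n ^ 2 / (1 - r) - (r * a n + b n) ^ 2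
        = r * ((1 - r) * a n - b n) ^ 2 / (1 - r) := by
      field_simp
      ring
    have h3 : 0 ≤ r * ((1 - r) * a n - b n) ^ 2 / (1 - r) := by positivity
    linarith
  have hsum : ∀ N : ℕ, ∑ n ∈ Finset.range (N + 1), a n ^ 2
      ≤ a 0 ^ 2 + r * ∑ n ∈ Finset.range N, a n ^ 2
        + (∑ n ∈ Finset.range N, b n ^ 2) / (1 - r) := by
    intro N
    rw [Finset.sum_range_succ', Finset.mul_sum, Finset.sum_div]
    have := Finset.sum_le_sum fun n (_ : n ∈ Finset.range N) => hstep n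
    rw [Finset.sum_add_distrib] at this
    linarith
  refine ⟨(a 0 ^ 2 + d / (1 - r)) / (1 - r), fun N => ?_⟩
  rcases N with _ | N
  · simp
  have hmono : ∑ n ∈ Finset.range N, a n ^ 2 ≤ ∑ n ∈ Finset.range (N + 1), a n ^ 2 := by
    rw [Finset.sum_range_succ]
    nlinarith [sq_nonneg (a N)]
  have h4 : (∑ n ∈ Finset.range N, b n ^ 2) / (1 - r) ≤ d / (1 - r) * (N + 1 : ℕ) := by
    rw [div_mul_eq_mul_div]
    refine div_le_div_of_nonneg_right ?_ h1r.le
    refine le_trans ?_ (hd (N + 1))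
    rw [Finset.sum_range_succ]
    nlinarith [sq_nonneg (b N)]
  have h5 : a 0 ^ 2 ≤ a 0 ^ 2 * (N + 1 : ℕ) := by
    push_cast
    nlinarith [sq_nonneg (a 0), (Nat.cast_nonneg N : (0 : ℝ) ≤ N)]
  have h6 := hsum N
  have h7 : r * ∑ n ∈ Finset.range N, a n ^ 2 ≤ r * ∑ n ∈ Finset.range (N + 1), a n ^ 2 := by
    gcongr
  rw [div_mul_eq_mul_div, le_div_iff₀ h1r]
  linarith

theorem tendsto_zero_of_contraction {u β : ℕ → ℝ} {r : ℝ} (hr0 : 0 ≤ r) (hr1 : r < 1)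
    (hu : ∀ n, 0 ≤ u n) (hstep : ∀ n, u (n + 1) ≤ r * u n + β n)
    (hβ : Tendsto β atTop (𝓝 0)) : Tendsto u atTop (𝓝 0) := by
  rw [Metric.tendsto_atTop]
  intro ε hε
  have h1r : 0 < 1 - r := by linarith
  obtain ⟨N, hN⟩ := eventually_atTop.1 (hβ.eventually_lt_const
    (show (0 : ℝ) < ε / 2 * (1 - r) by positivity))
  have hk : ∀ k : ℕ, u (N + k) ≤ r ^ k * u N + ε / 2 := by
    intro k
    induction k with
    | zero => simp; positivity
    | succ k ih =>
      have h1 := hstep (N + k)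
      have h2 := hN (N + k) (by omega)
      have h3 : r * u (N + k) ≤ r * (r ^ k * u N + ε / 2) := by gcongr
      rw [← add_assoc, pow_succ]
      nlinarith
  have hlim : Tendsto (fun k : ℕ => r ^ k * u N) atTop (𝓝 0) := by
    simpa using (tendsto_pow_atTop_nhds_zero_of_lt_one hr0 hr1).mul_const (u N)
  obtain ⟨M, hM⟩ := eventually_atTop.1
    (hlim.eventually_lt_const (show (0 : ℝ) < ε / 2 by positivity))
  refine ⟨N + M, fun n hn => ?_⟩
  obtain ⟨k, rfl⟩ := Nat.exists_eq_add_of_le (show N ≤ n by omega)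
  rw [Real.dist_0_eq_abs, abs_of_nonneg (hu _)]
  linarith [hk k, hM k (by omega)]

/-- Sublinear growth propagates through a scalar contraction. -/
theorem tendsto_div_zero_of_contraction {a b : ℕ → ℝ} {r : ℝ} (hr0 : 0 ≤ r) (hr1 : r < 1)
    (ha : ∀ n, 0 ≤ a n) (hb0 : ∀ n, 0 ≤ b n) (hab : ∀ n, a (n + 1) ≤ r * a n + b n)
    (hb : Tendsto (fun n : ℕ => b n / (n + 1)) atTop (𝓝 0)) :
    Tendsto (fun n : ℕ => a n / (n + 1)) atTop (𝓝 0) := by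
  refine tendsto_zero_of_contraction hr0 hr1 (fun n => div_nonneg (ha n) (by positivity)) ?_ hb
  intro n
  rw [← mul_div_assoc, ← add_div]
  have := ha n
  have := hb0 n
  push_cast
  calc a (n + 1) / ((n : ℝ) + 1 + 1) ≤ (r * a n + b n) / ((n : ℝ) + 1 + 1) := by
        gcongr; exact hab n
    _ ≤ _ := by gcongr; linarith

/-! ### A law of large numbers for martingale differences -/

section MartingaleLLN

variable {Ω : Type*} {mΩ : MeasurableSpace Ω} {μ : Measure Ω} {ℱ : Filtration ℕ mΩ} {a f : ℕ → Ω → ℝ} {v : ℝ}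

/-- The martingale transform `∑ a k * f k` of an independent sequence `f` by a bounded predictable
sequence `a` is square integrable. -/
theorem memLp_transform (ha : ∀ n, Measurable[ℱ n] (a n)) {C : ℝ} (hC : ∀ n t, |a n t| ≤ C)
    (hf2 : ∀ n, MemLp (f n) 2 μ) (n : ℕ) :
    MemLp (fun t => ∑ k ∈ Finset.range n, a k t * f k t) 2 μ := by
  refine memLp_finsetSum _ fun k _ => ?_
  have h1 : MemLp (a k) ⊤ μ :=
    memLp_top_of_bound ((ha k).mono (ℱ.le k) le_rfl).aestronglyMeasurable C
      (Eventually.of_forall fun t => hC k t)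
  exact (hf2 k).mul h1

theorem measurable_transform (ha : ∀ n, Measurable[ℱ n] (a n))
    (hf : ∀ n, Measurable[ℱ (n + 1)] (f n)) (n : ℕ) :
    Measurable[ℱ n] fun t => ∑ k ∈ Finset.range n, a k t * f k t := by
  refine Finset.measurable_fun_sum _ fun k hk => ?_
  have hk := Finset.mem_range.1 hk
  exact ((ha k).mono (ℱ.mono hk.le) le_rfl).mul ((hf k).mono (ℱ.mono hk) le_rfl)

variable [IsProbabilityMeasure μ]

theorem martingale_transform (ha : ∀ n, Measurable[ℱ n] (a n)) {C : ℝ}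
    (hC : ∀ n t, |a n t| ≤ C) (hf : ∀ n, Measurable[ℱ (n + 1)] (f n))
    (hf2 : ∀ n, MemLp (f n) 2 μ)
    (hind : ∀ n, Indep (MeasurableSpace.comap (f n) inferInstance) (ℱ n) μ)
    (hmean : ∀ n, ∫ t, f n t ∂μ = 0) :
    Martingale (fun n t => ∑ k ∈ Finset.range n, a k t * f k t) ℱ μ := by
  refine martingale_of_condExp_sub_eq_zero_nat
    (fun n => (measurable_transform ha hf n).stronglyMeasurable)
    (fun n => (memLp_transform ha hC hf2 n).integrable one_le_two) fun n => ?_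
  have h1 : (fun t => ∑ k ∈ Finset.range (n + 1), a k t * f k t)
      - (fun t => ∑ k ∈ Finset.range n, a k t * f k t) = a n * f n := by
    ext t
    simp [Finset.sum_range_succ]
  rw [h1]
  have hfm : Measurable (f n) := (hf n).mono (ℱ.le _) le_rfl
  have h2 : μ[a n * f n|ℱ n] =ᵐ[μ] a n * μ[f n|ℱ n] :=
    condExp_stronglyMeasurable_mul_of_bound (ℱ.le n) (ha n).stronglyMeasurable
      ((hf2 n).integrable one_le_two) C (Eventually.of_forall fun t => hC n t)
  have h3 : μ[f n|ℱ n] =ᵐ[μ] fun _ => ∫ t, f n t ∂μ :=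
    condExp_indep_eq hfm.comap_le (ℱ.le n) (comap_measurable (f n)).stronglyMeasurable (hind n)
  filter_upwards [h2, h3] with t h2 h3
  simp [h2, h3, hmean n]

/-- Orthogonality of the increments: `f n` is centred and independent of the past, so the cross term
with the previous sum integrates to zero. -/
theorem integral_sq_transform (ha : ∀ n, Measurable[ℱ n] (a n)) {C : ℝ}
    (hC : ∀ n t, |a n t| ≤ C) (hf : ∀ n, Measurable[ℱ (n + 1)] (f n))
    (hf2 : ∀ n, MemLp (f n) 2 μ)
    (hind : ∀ n, Indep (MeasurableSpace.comap (f n) inferInstance) (ℱ n) μ)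
    (hmean : ∀ n, ∫ t, f n t ∂μ = 0) (hvar : ∀ n, ∫ t, f n t ^ 2 ∂μ = v) (n : ℕ) :
    ∫ t, (∑ k ∈ Finset.range n, a k t * f k t) ^ 2 ∂μ
      = v * ∫ t, ∑ k ∈ Finset.range n, a k t ^ 2 ∂μ := by
  have haint : ∀ k, Integrable (fun t => a k t ^ 2) μ := fun k =>
    (MemLp.of_bound (p := 2) ((ha k).mono (ℱ.le k) le_rfl).aestronglyMeasurable C
      (Eventually.of_forall fun t => hC k t)).integrable_sq
  have hfm : ∀ n, Measurable (f n) := fun n => (hf n).mono (ℱ.le _) le_rfl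
  induction n with
  | zero => simp
  | succ n ih =>
    set M : Ω → ℝ := fun t => ∑ k ∈ Finset.range n, a k t * f k t with hM
    have hMm : Measurable[ℱ n] M := measurable_transform ha hf n
    have hM2 : MemLp M 2 μ := memLp_transform ha hC hf2 n
    have i1 : IndepFun (fun t => M t * a n t) (f n) μ :=
      (indep_of_indep_of_le_right (hind n) (hMm.mul (ha n)).comap_le).symm
    have i2 : IndepFun (fun t => a n t ^ 2) (fun t => f n t ^ 2) μ :=
      (indep_of_indep_of_le_left (indep_of_indep_of_le_right (hind n)
        ((ha n).pow_const 2).comap_le)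
        ((comap_measurable (f n)).pow_const 2).comap_le).symm
    have ham : ∀ k, Measurable (a k) := fun k => (ha k).mono (ℱ.le k) le_rfl
    have hMm' : Measurable M := hMm.mono (ℱ.le n) le_rfl
    have hMa : Integrable (fun t => M t * a n t) μ :=
      (hM2.integrable one_le_two).mul_bdd (c := C) (ham n).aestronglyMeasurable
        (Eventually.of_forall fun t => hC n t)
    have e1 : ∫ t, M t * a n t * f n t ∂μ = 0 := by
      rw [i1.integral_fun_mul_eq_mul_integral hMa.aestronglyMeasurable (hfm n).aestronglyMeasurable,
        hmean, mul_zero]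
    have e2 : ∫ t, a n t ^ 2 * f n t ^ 2 ∂μ = (∫ t, a n t ^ 2 ∂μ) * v := by
      rw [i2.integral_fun_mul_eq_mul_integral (haint n).aestronglyMeasurable
        ((hfm n).pow_const 2).aestronglyMeasurable, hvar]
    have j1 : Integrable (fun t => M t * a n t * f n t) μ :=
      i1.integrable_mul hMa ((hf2 n).integrable one_le_two)
    have j2 : Integrable (fun t => a n t ^ 2 * f n t ^ 2) μ :=
      i2.integrable_mul (haint n) (hf2 n).integrable_sq
    simp_rw [Finset.sum_range_succ]
    rw [integral_add (integrable_finsetSum _ fun k _ => haint k) (haint n), mul_add, ← ih]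
    change ∫ t, (M t + a n t * f n t) ^ 2 ∂μ = ∫ t, M t ^ 2 ∂μ + _
    have e3 : ∀ t, (M t + a n t * f n t) ^ 2
        = M t ^ 2 + (2 * (M t * a n t * f n t) + a n t ^ 2 * f n t ^ 2) := fun t => by ring
    have j3 : Integrable (fun t => 2 * (M t * a n t * f n t) + a n t ^ 2 * f n t ^ 2) μ :=
      (j1.const_mul 2).add j2
    simp_rw [e3]
    rw [integral_add hM2.integrable_sq j3, integral_add (j1.const_mul 2) j2,
      integral_const_mul, e1, e2]
    ring

/-- The second moments stay below v C, so |x| ≤ 1 + x² bounds the martingale in L¹ and Doob's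
convergence theorem applies. -/
theorem ae_tendsto_transform (ha : ∀ n, Measurable[ℱ n] (a n)) {C : ℝ}
    (hC : ∀ n t, ∑ k ∈ Finset.range n, a k t ^ 2 ≤ C) (hf : ∀ n, Measurable[ℱ (n + 1)] (f n))
    (hf2 : ∀ n, MemLp (f n) 2 μ)
    (hind : ∀ n, Indep (MeasurableSpace.comap (f n) inferInstance) (ℱ n) μ)
    (hmean : ∀ n, ∫ t, f n t ∂μ = 0) (hvar : ∀ n, ∫ t, f n t ^ 2 ∂μ = v) :
    ∀ᵐ t ∂μ, ∃ l, Tendsto (fun n => ∑ k ∈ Finset.range n, a k t * f k t) atTop (𝓝 l) := by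
  have hb : ∀ n t, |a n t| ≤ √C := fun n t => by
    refine Real.abs_le_sqrt (le_trans ?_ (hC (n + 1) t))
    rw [Finset.sum_range_succ]
    have : 0 ≤ ∑ k ∈ Finset.range n, a k t ^ 2 := Finset.sum_nonneg fun k _ => sq_nonneg _
    linarith
  have hv : 0 ≤ v := by
    rw [← hvar 0]
    exact integral_nonneg fun t => sq_nonneg _
  have hmart := martingale_transform ha hb hf hf2 hind hmean
  refine hmart.submartingale.exists_ae_tendsto_of_bdd (R := (1 + v * C).toNNReal) fun n => ?_
  have hM2 := memLp_transform ha hb hf2 n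
  have hM1 := hM2.integrable one_le_two
  rw [eLpNorm_one_eq_lintegral_enorm, ← ofReal_integral_norm_eq_lintegral_enorm hM1]
  refine ENNReal.ofReal_le_ofReal ?_
  have h1 := integral_sq_transform ha hb hf hf2 hind hmean hvar n
  have h2 : ∫ t, ∑ k ∈ Finset.range n, a k t ^ 2 ∂μ ≤ C := by
    have hi : Integrable (fun t => ∑ k ∈ Finset.range n, a k t ^ 2) μ :=
      integrable_finsetSum _ fun k _ =>
        (MemLp.of_bound (p := 2) ((ha k).mono (ℱ.le k) le_rfl).aestronglyMeasurable _
          (Eventually.of_forall fun t => hb k t)).integrable_sq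
    calc _ ≤ ∫ _, C ∂μ := integral_mono hi (integrable_const C) fun t => hC n t
      _ = C := by simp
  calc ∫ t, ‖∑ k ∈ Finset.range n, a k t * f k t‖ ∂μ
      ≤ ∫ t, (1 + (∑ k ∈ Finset.range n, a k t * f k t) ^ 2) ∂μ := by
        refine integral_mono hM1.norm ((integrable_const 1).add hM2.integrable_sq) fun t => ?_
        simp only [Real.norm_eq_abs]
        nlinarith [sq_abs (∑ k ∈ Finset.range n, a k t * f k t),
          sq_nonneg (|∑ k ∈ Finset.range n, a k t * f k t| - 1)]
    _ = 1 + v * ∫ t, ∑ k ∈ Finset.range n, a k t ^ 2 ∂μ := by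
        rw [integral_add (integrable_const 1) hM2.integrable_sq, h1]
        simp
    _ ≤ 1 + v * C := by gcongr

/-- If `s` is predictable with bounded average power and `f n` is centred, of constant variance
and independent of the past, then `s n * f n` averages to zero. -/
theorem ae_tendsto_avg_mul {s : ℕ → Ω → ℝ} (hs : ∀ n, Measurable[ℱ n] (s n))
    (hf : ∀ n, Measurable[ℱ (n + 1)] (f n)) (hf2 : ∀ n, MemLp (f n) 2 μ)
    (hind : ∀ n, Indep (MeasurableSpace.comap (f n) inferInstance) (ℱ n) μ)
    (hmean : ∀ n, ∫ t, f n t ∂μ = 0) (hvar : ∀ n, ∫ t, f n t ^ 2 ∂μ = v)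
    (hb : ∀ᵐ t ∂μ, ∃ c : ℝ, ∀ N : ℕ, ∑ n ∈ Finset.range N, s n t ^ 2 ≤ c * N) :
    ∀ᵐ t ∂μ, Tendsto (fun N : ℕ => (1 / (N : ℝ)) * ∑ n ∈ Finset.range N, s n t * f n t)
      atTop (𝓝 0) := by
  classical
  set T : ℕ → Ω → ℝ := fun n t => ∑ k ∈ Finset.range n, (s k t / (k + 1)) ^ 2 with hT
  have hTm : ∀ n, Measurable[ℱ n] (T (n + 1)) := fun n =>
    Finset.measurable_fun_sum _ fun k hk =>
      (((hs k).mono (ℱ.mono (Finset.mem_range_succ_iff.1 hk)) le_rfl).div_const _).pow_const 2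
  have hTmono : ∀ t, Monotone fun n => T n t := fun t => monotone_nat_of_le_succ fun n => by
    simp only [hT, Finset.sum_range_succ]
    have := sq_nonneg (s n t / (n + 1))
    linarith
  -- Localization: the weights are cut off once their sum of squares exceeds `c`. They remain
  -- predictable because `T (n + 1)` involves only `s 0, …, s n`. Almost every path has bounded `T`,
  -- so some integer level leaves it untouched.
  set a : ℕ → ℕ → Ω → ℝ := fun c n t => if T (n + 1) t ≤ c then s n t / (n + 1) else 0 with ha
  have ham : ∀ c n, Measurable[ℱ n] (a c n) := fun c n =>
    Measurable.ite (hTm n measurableSet_Iic)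
      ((hs n).div_const _) measurable_const
  have hab : ∀ (c n : ℕ) t, ∑ k ∈ Finset.range n, a c k t ^ 2 ≤ c := by
    intro c n t
    induction n with
    | zero => simp
    | succ n ih =>
      by_cases h : T (n + 1) t ≤ c
      · refine le_trans (Finset.sum_le_sum fun k _ => ?_) h
        simp only [ha]
        split_ifs
        · exact le_rfl
        · rw [zero_pow two_ne_zero]; positivity
      · rw [Finset.sum_range_succ]
        simpa [ha, h] using ih
  have hconv := ae_all_iff.2 fun c : ℕ =>
    ae_tendsto_transform (ham c) (hab c) hf hf2 hind hmean hvar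
  filter_upwards [hconv, hb] with t hconv ⟨c, hc⟩
  obtain ⟨k, hk⟩ := exists_nat_ge (2 * c)
  obtain ⟨l, hl⟩ := hconv k
  refine tendsto_avg_of_tendsto_sum_div (l := l) (hl.congr fun n => ?_)
  refine Finset.sum_congr rfl fun j _ => ?_
  have : T (j + 1) t ≤ k := (sum_sq_div_sq_le hc (j + 1)).trans hk
  simp only [ha, this, if_true]
  ring

end MartingaleLLN

/-! ### Empirical covariances -/

/-- The averages of the matrices `a n (b n)ᵀ` converge to `M`. -/
def AvgCov {ι κ : Type*} (a : ℕ → ι → ℝ) (b : ℕ → κ → ℝ) (M : Matrix ι κ ℝ) : Prop :=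
  ∀ i j, Tendsto (fun N : ℕ => (1 / (N : ℝ)) * ∑ n ∈ Finset.range N, a n i * b n j) atTop
    (𝓝 (M i j))

/-- Every coordinate of `a` has bounded average power. -/
def PowerBounded {ι : Type*} (a : ℕ → ι → ℝ) : Prop :=
  ∀ i, ∃ c : ℝ, ∀ N : ℕ, ∑ n ∈ Finset.range N, a n i ^ 2 ≤ c * N

section AvgCov

variable {ι κ τ : Type*} {a a' : ℕ → ι → ℝ} {b b' : ℕ → κ → ℝ} {M M' : Matrix ι κ ℝ}

theorem AvgCov.swap (h : AvgCov a b M) : AvgCov b a Mᵀ := fun i j => by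
  simpa [mul_comm] using h j i

theorem AvgCov.of_eq (h : AvgCov a b M) (e : M = M') : AvgCov a b M' := e ▸ h

theorem AvgCov.unique (h : AvgCov a b M) (h' : AvgCov a b M') : M = M' := by
  ext i j
  exact tendsto_nhds_unique (h i j) (h' i j)

theorem AvgCov.add_left (h : AvgCov a b M) (h' : AvgCov a' b M') :
    AvgCov (fun n => a n + a' n) b (M + M') := fun i j => by
  simpa [add_mul, Finset.sum_add_distrib, mul_add] using (h i j).add (h' i j)

theorem AvgCov.neg_left (h : AvgCov a b M) : AvgCov (fun n => -a n) b (-M) := fun i j => by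
  simpa using (h i j).neg

theorem AvgCov.mulVec_left [Fintype ι] (H : Matrix τ ι ℝ) (h : AvgCov a b M) :
    AvgCov (fun n => H *ᵥ a n) b (H * M) := fun i j => by
  have h1 := tendsto_finsetSum Finset.univ fun k (_ : k ∈ Finset.univ) => (h k j).const_mul (H i k)
  refine (h1.congr fun N => ?_)
  simp only [Matrix.mulVec, dotProduct, Finset.sum_mul, Finset.mul_sum]
  rw [Finset.sum_comm]
  refine Finset.sum_congr rfl fun n _ => Finset.sum_congr rfl fun k _ => by ring

theorem AvgCov.add_right (h : AvgCov a b M) (h' : AvgCov a b' M') :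
    AvgCov a (fun n => b n + b' n) (M + M') := by
  simpa using (h.swap.add_left h'.swap).swap

theorem AvgCov.neg_right (h : AvgCov a b M) : AvgCov a (fun n => -b n) (-M) := by
  simpa using h.swap.neg_left.swap

theorem AvgCov.mulVec_right [Fintype κ] (H : Matrix τ κ ℝ) (h : AvgCov a b M) :
    AvgCov a (fun n => H *ᵥ b n) (M * Hᵀ) := by
  simpa using (h.swap.mulVec_left H).swap

theorem AvgCov.elim_left {c : ℕ → τ → ℝ} {M' : Matrix τ κ ℝ} (h : AvgCov a b M)
    (h' : AvgCov c b M') : AvgCov (fun n => Sum.elim (a n) (c n)) b (Matrix.fromRows M M') := by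
  rintro (i | i) j
  · exact h i j
  · exact h' i j

theorem AvgCov.elim_right {c : ℕ → τ → ℝ} {M' : Matrix ι τ ℝ} (h : AvgCov a b M)
    (h' : AvgCov a c M') : AvgCov a (fun n => Sum.elim (b n) (c n)) (Matrix.fromCols M M') := by
  rintro i (j | j)
  · exact h i j
  · exact h' i j

theorem AvgCov.powerBounded {M : Matrix ι ι ℝ} (h : AvgCov a a M) : PowerBounded a := by
  intro i
  obtain ⟨c, hc⟩ := (h i i).bddAbove_range
  refine ⟨c, fun N => ?_⟩
  rcases Nat.eq_zero_or_pos N with rfl | hN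
  · simp
  · have h1 : (1 / (N : ℝ)) * ∑ n ∈ Finset.range N, a n i * a n i ≤ c := hc ⟨N, rfl⟩
    have h2 : (0 : ℝ) < N := by exact_mod_cast hN
    rw [one_div, inv_mul_le_iff₀ h2] at h1
    simpa [sq, mul_comm] using h1

/-- A limit of averages of squares is nonnegative. This supplies the positivity of the noise
covariances, which is not assumed separately. -/
theorem AvgCov.posSemidef [Fintype ι] {M : Matrix ι ι ℝ} (h : AvgCov a a M) : M.PosSemidef := by
  refine Matrix.posSemidef_iff_dotProduct_mulVec.2 ⟨?_, fun x => ?_⟩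
  · rw [Matrix.IsHermitian, Matrix.conjTranspose_eq_transpose_of_trivial]
    exact h.swap.unique h
  · have h1 := (h.mulVec_left (Matrix.replicateRow Unit x)).mulVec_right (Matrix.replicateRow Unit x)
    have h2 := ge_of_tendsto' (h1 () ()) (b := 0) fun N => by
      have : 0 ≤ ∑ n ∈ Finset.range N, (Matrix.replicateRow Unit x *ᵥ a n) ()
          * (Matrix.replicateRow Unit x *ᵥ a n) () :=
        Finset.sum_nonneg fun n _ => mul_self_nonneg _
      positivity
    refine h2.trans_eq ?_
    simp [Matrix.mul_apply, dotProduct, Matrix.mulVec, Finset.mul_sum, Finset.sum_mul]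
    rw [Finset.sum_comm]
    refine Finset.sum_congr rfl fun n _ => Finset.sum_congr rfl fun k _ => by ring

theorem PowerBounded.add (h : PowerBounded a) (h' : PowerBounded a') :
    PowerBounded fun n => a n + a' n := by
  intro i
  obtain ⟨c, hc⟩ := h i
  obtain ⟨c', hc'⟩ := h' i
  refine ⟨2 * c + 2 * c', fun N => ?_⟩
  calc ∑ n ∈ Finset.range N, (a n + a' n) i ^ 2
      ≤ ∑ n ∈ Finset.range N, (2 * a n i ^ 2 + 2 * a' n i ^ 2) :=
        Finset.sum_le_sum fun n _ => by
          simp only [Pi.add_apply]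
          nlinarith [sq_nonneg (a n i - a' n i)]
    _ = 2 * ∑ n ∈ Finset.range N, a n i ^ 2 + 2 * ∑ n ∈ Finset.range N, a' n i ^ 2 := by
        rw [Finset.sum_add_distrib, Finset.mul_sum, Finset.mul_sum]
    _ ≤ _ := by nlinarith [hc N, hc' N]

theorem PowerBounded.neg (h : PowerBounded a) : PowerBounded fun n => -a n := by
  simpa [PowerBounded] using h

theorem PowerBounded.mulVec [Fintype ι] (H : Matrix τ ι ℝ) (h : PowerBounded a) :
    PowerBounded fun n => H *ᵥ a n := by
  intro i
  choose c hc using h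
  refine ⟨(∑ k, H i k ^ 2) * ∑ k, c k, fun N => ?_⟩
  calc ∑ n ∈ Finset.range N, (H *ᵥ a n) i ^ 2
      ≤ ∑ n ∈ Finset.range N, (∑ k, H i k ^ 2) * ∑ k, a n k ^ 2 :=
        Finset.sum_le_sum fun n _ => Finset.sum_mul_sq_le_sq_mul_sq _ _ _
    _ = (∑ k, H i k ^ 2) * ∑ k, ∑ n ∈ Finset.range N, a n k ^ 2 := by
        rw [← Finset.mul_sum, Finset.sum_comm]
    _ ≤ (∑ k, H i k ^ 2) * ∑ k, c k * N := by
        gcongr with k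
        exact hc k N
    _ = _ := by rw [← Finset.sum_mul, mul_assoc]

theorem PowerBounded.elim {c : ℕ → τ → ℝ} (h : PowerBounded a) (h' : PowerBounded c) :
    PowerBounded fun n => Sum.elim (a n) (c n) := by
  rintro (i | i)
  · exact h i
  · exact h' i

theorem PowerBounded.comp_add (h : PowerBounded a) (d : ℕ) :
    PowerBounded fun n => a (n + d) := by
  intro i
  obtain ⟨c, hc⟩ := h i
  have hc0 : 0 ≤ c := by simpa using (sq_nonneg (a 0 i)).trans (by simpa using hc 1)
  refine ⟨c * (d + 1), fun N => ?_⟩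
  rcases N with _ | N
  · simp
  have h1 := hc (N + 1 + d)
  rw [add_comm (N + 1) d, Finset.sum_range_add] at h1
  have h2 : 0 ≤ ∑ n ∈ Finset.range d, a n i ^ 2 := Finset.sum_nonneg fun n _ => sq_nonneg _
  simp_rw [add_comm _ d]
  push_cast at h1 ⊢
  have : c * ((d : ℝ) + 1) * (N + 1) = c * (d + (N + 1)) + c * (d * N) := by ring
  have : 0 ≤ c * ((d : ℝ) * N) := by positivity
  linarith

/-- Shifting both sequences does not change the limit of the averages. -/
theorem AvgCov.comp_add_iff (d : ℕ) :
    AvgCov (fun n => a (n + d)) (fun n => b (n + d)) M ↔ AvgCov a b M := by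
  refine forall_congr' fun i => forall_congr' fun j => ?_
  set g : ℕ → ℝ := fun n => a n i * b n j
  change Tendsto (fun N : ℕ => (1 / (N : ℝ)) * ∑ n ∈ Finset.range N, g (n + d)) atTop _ ↔
    Tendsto (fun N : ℕ => (1 / (N : ℝ)) * ∑ n ∈ Finset.range N, g n) atTop _
  have hd : Tendsto (fun N : ℕ => (d : ℝ) / N) atTop (𝓝 0) :=
    tendsto_const_div_atTop_nhds_zero_nat _
  have hq : Tendsto (fun N : ℕ => 1 + (d : ℝ) / N) atTop (𝓝 1) := by
    simpa using hd.const_add 1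
  have hs : Tendsto (fun N : ℕ => (∑ n ∈ Finset.range d, g n) / N) atTop (𝓝 0) :=
    tendsto_const_div_atTop_nhds_zero_nat _
  have key : ∀ᶠ N : ℕ in atTop, (1 / (N : ℝ)) * ∑ n ∈ Finset.range N, g (n + d)
      = (1 + (d : ℝ) / N) * ((1 / ((N + d : ℕ) : ℝ)) * ∑ n ∈ Finset.range (N + d), g n)
        - (∑ n ∈ Finset.range d, g n) / N := by
    filter_upwards [eventually_gt_atTop 0] with N hN
    rw [add_comm N d, Finset.sum_range_add]
    simp_rw [add_comm _ d]
    have : (N : ℝ) ≠ 0 := by positivity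
    push_cast
    field_simp
    ring
  rw [← tendsto_add_atTop_iff_nat d (f := fun N : ℕ => (1 / (N : ℝ)) * ∑ n ∈ Finset.range N, g n),
    tendsto_congr' key]
  constructor
  · intro h
    have h1 := (h.add hs).div hq one_ne_zero
    rw [add_zero, div_one] at h1
    refine h1.congr' ?_
    filter_upwards [eventually_gt_atTop 0] with N hN
    have : (1 + (d : ℝ) / N) ≠ 0 := by positivity
    simp only [Pi.div_apply, sub_add_cancel]
    field_simp
  · intro h
    simpa using (hq.mul h).sub hs

end AvgCov

/-! ### Laws of large numbers for Gaussian noise -/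

theorem IsCenteredGaussian.coord_memLp {Ω : Type*} [MeasurableSpace Ω] {μ : Measure Ω}
    {d : ℕ} {X : Ω → Fin d → ℝ} {S : Matrix (Fin d) (Fin d) ℝ} (h : IsCenteredGaussian μ X S)
    (i : Fin d) : MemLp (fun t => X t i) 2 μ :=
  h.gaussian.memLp_two.continuousLinearMap_comp (ContinuousLinearMap.proj (R := ℝ) i)

/-- The characteristic function of a Gaussian law depends only on the mean and variance of linear
functionals, here 0 and the quadratic form of `S`. The strong law needs this identity of laws. -/
theorem IsCenteredGaussian.identDistrib {Ω : Type*} [MeasurableSpace Ω] {μ : Measure Ω}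
    [IsProbabilityMeasure μ] {d : ℕ} {X X' : Ω → Fin d → ℝ} {S : Matrix (Fin d) (Fin d) ℝ}
    (h : IsCenteredGaussian μ X S) (h' : IsCenteredGaussian μ X' S) :
    IdentDistrib X X' μ μ := by
  have key : ∀ {X : Ω → Fin d → ℝ}, IsCenteredGaussian μ X S → ∀ L : StrongDual ℝ (Fin d → ℝ),
      charFunDual (μ.map X) L
        = Complex.exp (-((∑ i, ∑ j, L (Pi.single i 1) * L (Pi.single j 1) * S i j : ℝ) : ℂ) / 2) := by
    intro X h L
    have hL : ∀ x : Fin d → ℝ, L x = ∑ i, L (Pi.single i 1) * x i := fun x => by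
      conv_lhs => rw [← Finset.univ_sum_single x]
      rw [map_sum]
      refine Finset.sum_congr rfl fun i _ => ?_
      have : Pi.single i (x i) = x i • (Pi.single i 1 : Fin d → ℝ) := by
        rw [← Pi.single_smul, smul_eq_mul, mul_one]
      rw [this, map_smul, smul_eq_mul, mul_comm]
    have hm := h.coord_memLp
    have h1 : ∫ t, (L ∘ X) t ∂μ = 0 := by
      change ∫ t, L (X t) ∂μ = 0
      rw [integral_congr_ae (Eventually.of_forall fun t => hL (X t)),
        integral_finsetSum _ fun i _ => ((hm i).integrable one_le_two).const_mul _]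
      exact Finset.sum_eq_zero fun i _ => by rw [integral_const_mul, h.mean i, mul_zero]
    have h2 : Var[L ∘ X; μ] = ∑ i, ∑ j, L (Pi.single i 1) * L (Pi.single j 1) * S i j := by
      rw [variance_of_integral_eq_zero (h.gaussian.map L).aemeasurable h1]
      have e : ∀ t, (L ∘ X) t ^ 2
          = ∑ i, ∑ j, L (Pi.single i 1) * L (Pi.single j 1) * (X t i * X t j) := fun t => by
        rw [Function.comp_apply, hL, sq, Finset.sum_mul_sum]
        exact Finset.sum_congr rfl fun i _ => Finset.sum_congr rfl fun j _ => by ring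
      have hij : ∀ i j, Integrable (fun t => X t i * X t j) μ := fun i j =>
        (hm i).integrable_mul (hm j)
      rw [integral_congr_ae (Eventually.of_forall e),
        integral_finsetSum _ fun i _ => integrable_finsetSum _ fun j _ => (hij i j).const_mul _]
      refine Finset.sum_congr rfl fun i _ => ?_
      rw [integral_finsetSum _ fun j _ => (hij i j).const_mul _]
      refine Finset.sum_congr rfl fun j _ => ?_
      rw [integral_const_mul, h.covariance]
    rw [h.gaussian.charFunDual_map_eq, h1, h2]
    congr 1
    simp [neg_div]
  have := h.gaussian.isGaussian_map
  have := h'.gaussian.isGaussian_map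
  refine ⟨h.gaussian.aemeasurable, h'.gaussian.aemeasurable, Measure.ext_of_charFunDual ?_⟩
  ext L
  rw [key h, key h']

section Noise

variable {Ω : Type*} {mΩ : MeasurableSpace Ω} {μ : Measure Ω} {I : Type*} {β : I → Type*}
  [mβ : ∀ i, MeasurableSpace (β i)] {Y : ∀ i, Ω → β i}

/-- At time `n`, the information contained in all sources except `c n, c (n + 1), …`. -/
def pastFiltration (hY : ∀ i, Measurable (Y i)) (c : ℕ → I) : Filtration ℕ mΩ where
  seq n := ⨆ i ∈ {i | ∀ j, n ≤ j → i ≠ c j}, (mβ i).comap (Y i)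
  mono' _ _ hkl := biSup_mono fun _ hi j hj => hi j (hkl.trans hj)
  le' _ := iSup₂_le fun i _ => (hY i).comap_le

theorem measurable_pastFiltration (hY : ∀ i, Measurable (Y i)) {c : ℕ → I} {n : ℕ} {i : I}
    (hi : ∀ j, n ≤ j → i ≠ c j) : Measurable[pastFiltration hY c n] (Y i) :=
  (comap_measurable (Y i)).mono
    (le_iSup₂_of_le (f := fun i (_ : i ∈ {i | ∀ j, n ≤ j → i ≠ c j}) => (mβ i).comap (Y i))
      i hi le_rfl) le_rfl

/-- The filtration withholds only the present and future of the one noise `c`. Future values of the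
other noises count as known, so a residual at a later time can still be predictable. -/
theorem indep_pastFiltration (hY : ∀ i, Measurable (Y i)) (hind : iIndepFun Y μ) (c : ℕ → I)
    (n : ℕ) : Indep ((mβ (c n)).comap (Y (c n))) (pastFiltration hY c n) μ := by
  have h := indep_iSup_of_disjoint (m := fun i => (mβ i).comap (Y i)) (fun i => (hY i).comap_le)
    hind (S := {c n}) (T := {i | ∀ j, n ≤ j → i ≠ c j})
    (Set.disjoint_singleton_left.2 fun h => h n le_rfl rfl)
  rwa [iSup_singleton] at h

variable [IsProbabilityMeasure μ] {d : ℕ} {f : ℕ → Ω → Fin d → ℝ} {S : Matrix (Fin d) (Fin d) ℝ}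
  {c : ℕ → I}

/-- The empirical covariance of a Gaussian noise converges to its covariance. -/
theorem ae_avgCov_noise (hind : iIndepFun Y μ)
    (hc : Function.Injective c) (hf : ∀ n, Measurable[(mβ (c n)).comap (Y (c n))] (f n))
    (hg : ∀ n, IsCenteredGaussian μ (f n) S) :
    ∀ᵐ t ∂μ, AvgCov (fun n => f n t) (fun n => f n t) S := by
  refine ae_all_iff.2 fun i => ae_all_iff.2 fun j => ?_
  have hm : Measurable fun x : Fin d → ℝ => x i * x j := by fun_prop
  have h := strong_law_ae_real (μ := μ) (fun n t => f n t i * f n t j)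
    (((hg 0).coord_memLp i).integrable_mul ((hg 0).coord_memLp j))
    (fun k l hkl => by
      have h1 : Indep ((mβ (c k)).comap (Y (c k))) ((mβ (c l)).comap (Y (c l))) μ :=
        iIndepFun.indepFun hind (hc.ne hkl)
      exact indep_of_indep_of_le_left (indep_of_indep_of_le_right h1 (hm.comp (hf l)).comap_le)
        (hm.comp (hf k)).comap_le)
    (fun n => ((hg n).identDistrib (hg 0)).comp hm)
  filter_upwards [h] with t ht
  rw [(hg 0).covariance] at ht
  refine ht.congr fun N => ?_
  rw [div_eq_inv_mul, one_div]

/-- A sequence of bounded power that does not depend on the present and future noise is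
asymptotically uncorrelated with the noise. -/
theorem ae_avgCov_zero (hY : ∀ i, Measurable (Y i)) (hind : iIndepFun Y μ)
    (hc : Function.Injective c) (hf : ∀ n, Measurable[(mβ (c n)).comap (Y (c n))] (f n))
    (hg : ∀ n, IsCenteredGaussian μ (f n) S) {κ : Type*} [Countable κ] {s : ℕ → Ω → κ → ℝ}
    (hs : ∀ n, Measurable[pastFiltration hY c n] (s n))
    (hb : ∀ᵐ t ∂μ, PowerBounded fun n => s n t) :
    ∀ᵐ t ∂μ, AvgCov (fun n => s n t) (fun n => f n t) 0 := by
  refine ae_all_iff.2 fun i => ae_all_iff.2 fun j => ?_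
  have hfj : ∀ n, Measurable[(mβ (c n)).comap (Y (c n))] fun t => f n t j := fun n =>
    (measurable_pi_apply j).comp (hf n)
  refine ae_tendsto_avg_mul (ℱ := pastFiltration hY c) (v := S j j)
    (s := fun n t => s n t i) (f := fun n t => f n t j)
    (fun n => (measurable_pi_apply i).comp (hs n)) (fun n => (hfj n).mono ?_ le_rfl)
    (fun n => (hg n).coord_memLp j)
    (fun n => indep_of_indep_of_le_left (indep_pastFiltration hY hind c n) (hfj n).comap_le)
    (fun n => (hg n).mean j) (fun n => by simpa [sq] using (hg n).covariance j j)
    (hb.mono fun t ht => ht i)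
  exact (measurable_pastFiltration hY fun k hk => hc.ne (by omega)).comap_le

end Noise

/-! ### Stable linear recursions -/

section Gauge

variable {E : Type*} [NormedAddCommGroup E] [NormedSpace ℝ E]

/-- A linear map some power of which is a contraction is a contraction for an equivalent gauge. -/
theorem exists_contracting_gauge (T : E →ₗ[ℝ] E) {r b : ℝ} (hr : 0 < r) (hb : ∀ x, ‖T x‖ ≤ b * ‖x‖)
    {k : ℕ} (hk : 0 < k) (hT : ∀ x, ‖(T ^ k) x‖ ≤ r ^ k * ‖x‖) :
    ∃ (g : E → ℝ) (c : ℝ), (∀ x, ‖x‖ ≤ g x) ∧ (∀ x, g x ≤ c * ‖x‖) ∧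
      (∀ x y, g (x + y) ≤ g x + g y) ∧ ∀ x, g (T x) ≤ r * g x := by
  -- The adapted norm: applying `T` shifts the weighted sum by one index and gains a factor `r`; the
  -- new last term is bounded by the lost first one because `T ^ k` contracts by `r ^ k`.
  refine ⟨fun x => ∑ j ∈ Finset.range k, (r ^ j)⁻¹ * ‖(T ^ j) x‖,
    ∑ j ∈ Finset.range k, (r ^ j)⁻¹ * |b| ^ j, fun x => ?_, fun x => ?_, fun x y => ?_, fun x => ?_⟩
  · have := Finset.single_le_sum (f := fun j => (r ^ j)⁻¹ * ‖(T ^ j) x‖)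
      (fun j _ => by positivity) (Finset.mem_range.2 hk)
    simpa using this
  · have hpow : ∀ j, ‖(T ^ j) x‖ ≤ |b| ^ j * ‖x‖ := by
      intro j
      induction j with
      | zero => simp
      | succ j ih =>
        rw [pow_succ', Module.End.mul_apply, pow_succ', mul_assoc]
        refine (hb _).trans ?_
        gcongr
        exact le_abs_self b
    rw [Finset.sum_mul]
    refine Finset.sum_le_sum fun j _ => ?_
    rw [mul_assoc]
    gcongr
    exact hpow j
  · rw [← Finset.sum_add_distrib]
    refine Finset.sum_le_sum fun j _ => ?_
    rw [← mul_add, map_add]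
    gcongr
    exact norm_add_le _ _
  · obtain ⟨k, rfl⟩ := Nat.exists_eq_succ_of_ne_zero hk.ne'
    have h1 : ∀ j, (r ^ j)⁻¹ * ‖(T ^ j) (T x)‖ = r * ((r ^ (j + 1))⁻¹ * ‖(T ^ (j + 1)) x‖) := by
      intro j
      rw [pow_succ T, Module.End.mul_apply, pow_succ r]
      field_simp
    simp_rw [h1, ← Finset.mul_sum]
    gcongr ?_ * ?_
    rw [Finset.sum_range_succ, Finset.sum_range_succ']
    refine add_le_add le_rfl ?_
    rw [pow_zero, pow_zero, inv_one, one_mul, Module.End.one_apply, inv_mul_le_iff₀ (by positivity)]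
    exact hT x

end Gauge

theorem mul_eq_zero_of_posSemidef {ι κ : Type*} [Fintype ι] {Q : Matrix ι ι ℝ} (hQ : Q.PosSemidef)
    {H : Matrix κ ι ℝ} (h : H * Q * Hᵀ = 0) : H * Q = 0 := by
  have h3 : ∀ i, Q *ᵥ H i = 0 := fun i => by
    rw [← hQ.dotProduct_mulVec_zero_iff]
    have := congrFun (congrFun h i) i
    rw [Matrix.mul_assoc] at this
    simpa [Matrix.mul_apply, dotProduct, Matrix.mulVec] using this
  have h4 : Qᵀ = Q := by simpa using hQ.1.eq
  ext i j
  have := congrFun (h3 i) j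
  rw [← h4, Matrix.mulVec_transpose] at this
  simpa [Matrix.mul_apply, Matrix.vecMul, dotProduct] using this

section Stable

attribute [local instance] Matrix.frobeniusNormedAddCommGroup Matrix.frobeniusNormedSpace
  Matrix.frobeniusNormedRing Matrix.frobeniusNormedAlgebra

variable {ι : Type*} [Fintype ι] [DecidableEq ι]

/-- Some power of `F` is a strict contraction in the Frobenius norm. -/
def IsStable (F : Matrix ι ι ℝ) : Prop :=
  ∃ r : ℝ, 0 < r ∧ r < 1 ∧ ∀ᶠ k : ℕ in atTop, ‖F ^ k‖ ≤ r ^ k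

/-- Gelfand's formula over ℂ, with a rate chosen between the spectral radius and 1. -/
theorem isStable_of_spectrum {F : Matrix ι ι ℝ}
    (hF : ∀ z ∈ spectrum ℂ (F.map (fun t : ℝ => (t : ℂ))), ‖z‖ < 1) : IsStable F := by
  rcases isEmpty_or_nonempty ι with hι | hι
  · refine ⟨1 / 2, by norm_num, by norm_num, Eventually.of_forall fun k => ?_⟩
    have : F ^ k = 0 := Subsingleton.elim _ _
    rw [this, norm_zero]
    positivity
  · set G : Matrix ι ι ℂ := F.map (fun t : ℝ => (t : ℂ)) with hG
    have : CompleteSpace (Matrix ι ι ℂ) := FiniteDimensional.complete ℂ _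
    have hρ : spectralRadius ℂ G < ((1 : NNReal) : ENNReal) :=
      spectrum.spectralRadius_lt_of_forall_lt G fun z hz => by
        exact_mod_cast hF z hz
    obtain ⟨r, hr1, hr2⟩ := ENNReal.lt_iff_exists_nnreal_btwn.1 hρ
    have hev := (spectrum.pow_nnnorm_pow_one_div_tendsto_nhds_spectralRadius G).eventually
      (gt_mem_nhds hr1)
    have hr0 : 0 < r := by exact_mod_cast (zero_le (a := spectralRadius ℂ G)).trans_lt hr1
    refine ⟨r, by exact_mod_cast hr0, by exact_mod_cast hr2, ?_⟩
    filter_upwards [hev, eventually_gt_atTop 0] with k hk hk0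
    have hk' : ((‖G ^ k‖₊ : ENNReal)) ≤ (r : ENNReal) ^ k := by
      have h := ENNReal.rpow_le_rpow hk.le (Nat.cast_nonneg k : (0 : ℝ) ≤ k)
      rwa [← ENNReal.rpow_mul, one_div_mul_cancel (by positivity), ENNReal.rpow_one,
        ENNReal.rpow_natCast] at h
    have hmap : G ^ k = (F ^ k).map (fun t : ℝ => (t : ℂ)) :=
      ((Complex.ofRealHom.mapMatrix).map_pow F k).symm
    have hn : ‖G ^ k‖ = ‖F ^ k‖ := by
      rw [hmap]
      exact Matrix.frobenius_norm_map_eq _ _ fun a => Complex.norm_real a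
    rw [← hn]
    exact_mod_cast hk'

theorem IsSchurStable.fromBlocks {p : ℕ} {F G : Matrix (Fin p) (Fin p) ℝ} (hG : IsSchurStable G)
    (hF : IsSchurStable F) (R : Matrix (Fin p) (Fin p) ℝ) :
    IsStable (Matrix.fromBlocks G R 0 F) := by
  refine isStable_of_spectrum fun z hz => ?_
  rw [Matrix.fromBlocks_map, Matrix.mem_spectrum_iff_isRoot_charpoly,
    show (0 : Matrix (Fin p) (Fin p) ℝ).map (fun t : ℝ => (t : ℂ)) = 0 by ext; simp,
    Matrix.charpoly_fromBlocks_zero₂₁, Polynomial.IsRoot.def, Polynomial.eval_mul,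
    mul_eq_zero] at hz
  rcases hz with hz | hz
  · exact hG z (Matrix.mem_spectrum_iff_isRoot_charpoly.2 hz)
  · exact hF z (Matrix.mem_spectrum_iff_isRoot_charpoly.2 hz)

theorem IsStable.summable {F : Matrix ι ι ℝ} (hF : IsStable F)
    (Q : Matrix ι ι ℝ) : Summable fun k : ℕ => F ^ k * Q * (F ^ k)ᵀ := by
  have : CompleteSpace (Matrix ι ι ℝ) := FiniteDimensional.complete ℝ _
  obtain ⟨r, hr0, hr1, hr⟩ := hF
  have hs : Summable fun k : ℕ => ‖Q‖ * (r ^ 2) ^ k :=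
    (summable_geometric_of_lt_one (by positivity) (by nlinarith)).mul_left _
  refine Summable.of_norm_bounded_eventually_nat hs ?_
  filter_upwards [hr] with k hk
  calc ‖F ^ k * Q * (F ^ k)ᵀ‖ ≤ ‖F ^ k‖ * ‖Q‖ * ‖(F ^ k)ᵀ‖ :=
        (norm_mul_le _ _).trans (by gcongr; exact norm_mul_le _ _)
    _ = ‖F ^ k‖ * ‖Q‖ * ‖F ^ k‖ := by rw [Matrix.frobenius_norm_transpose]
    _ ≤ r ^ k * ‖Q‖ * r ^ k := by gcongr
    _ = ‖Q‖ * (r ^ 2) ^ k := by ring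

/-- The stationary covariance of `x (n+1) = F x n + η n` when `η` has covariance `Q`. -/
noncomputable def stationaryCov (F Q : Matrix ι ι ℝ) : Matrix ι ι ℝ :=
  ∑' k : ℕ, F ^ k * Q * (F ^ k)ᵀ

theorem stationaryCov_eq {F : Matrix ι ι ℝ} (hF : IsStable F) (Q : Matrix ι ι ℝ) :
    stationaryCov F Q = F * stationaryCov F Q * Fᵀ + Q := by
  have hs := hF.summable Q
  have h1 := hs.tsum_eq_zero_add
  have h2 : ∑' k : ℕ, F ^ (k + 1) * Q * (F ^ (k + 1))ᵀ
      = F * (∑' k : ℕ, F ^ k * Q * (F ^ k)ᵀ) * Fᵀ := by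
    rw [← hs.tsum_mul_left, ← (hs.mul_left F).tsum_mul_right]
    refine tsum_congr fun k => ?_
    rw [pow_succ', Matrix.transpose_mul]
    noncomm_ring
  rw [h2] at h1
  rw [stationaryCov]
  conv_lhs => rw [h1]
  simp [add_comm]

/-- Iterating the equation leaves a remainder F^n S (F^n)ᵀ, which tends to zero. Positivity of `S`
plays no role. -/
theorem eq_stationaryCov {F Q S : Matrix ι ι ℝ} (hF : IsStable F) (hS : S = F * S * Fᵀ + Q) :
    S = stationaryCov F Q := by
  have hrep : ∀ n : ℕ, S = F ^ n * S * (F ^ n)ᵀ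
      + ∑ k ∈ Finset.range n, F ^ k * Q * (F ^ k)ᵀ := by
    intro n
    induction n with
    | zero => simp
    | succ n ih =>
      rw [Finset.sum_range_succ, pow_succ, Matrix.transpose_mul]
      conv_lhs => rw [ih]
      conv_lhs => rw [hS]
      noncomm_ring
  have h0 := (hF.summable S).tendsto_atTop_zero
  have h1 := h0.add (hF.summable Q).hasSum.tendsto_sum_nat
  rw [zero_add] at h1
  exact tendsto_nhds_unique (tendsto_const_nhds (x := S)) (h1.congr fun n => (hrep n).symm)

theorem stationaryCov_add {F : Matrix ι ι ℝ} (hF : IsStable F) (Q Q' : Matrix ι ι ℝ) :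
    stationaryCov F (Q + Q') = stationaryCov F Q + stationaryCov F Q' := by
  refine (eq_stationaryCov hF ?_).symm
  conv_lhs => rw [stationaryCov_eq hF Q, stationaryCov_eq hF Q']
  noncomm_ring

theorem hasSum_mul_stationaryCov_mul {F : Matrix ι ι ℝ} (hF : IsStable F) (Q : Matrix ι ι ℝ)
    {κ : Type*} [Fintype κ] (H : Matrix κ ι ℝ) :
    HasSum (fun k : ℕ => (H * F ^ k) * Q * (H * F ^ k)ᵀ) (H * stationaryCov F Q * Hᵀ) := by
  have hc : Continuous fun M : Matrix ι ι ℝ => H * M * Hᵀ :=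
    (continuous_const.matrix_mul continuous_id).matrix_mul continuous_const
  have h : HasSum (fun k : ℕ => H * (F ^ k * Q * (F ^ k)ᵀ) * Hᵀ) (H * stationaryCov F Q * Hᵀ) :=
    (hF.summable Q).hasSum.map
    (⟨⟨fun M : Matrix ι ι ℝ => H * M * Hᵀ, by simp⟩, fun x y => by
      simp [Matrix.mul_add, Matrix.add_mul]⟩ : Matrix ι ι ℝ →+ Matrix κ κ ℝ) hc
  convert h using 1
  ext1 k
  simp [Matrix.mul_assoc]

/-- If the stationary output covariance vanishes, so does the contribution of every delay. -/
theorem mul_pow_mul_eq_zero {F Q : Matrix ι ι ℝ} (hF : IsStable F) (hQ : Q.PosSemidef)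
    {κ : Type*} [Fintype κ] {H : Matrix κ ι ℝ} (h0 : H * stationaryCov F Q * Hᵀ = 0) (k : ℕ) :
    H * F ^ k * Q = 0 := by
  have h := hasSum_mul_stationaryCov_mul hF Q H
  rw [h0] at h
  have hpsd : ∀ k, ((H * F ^ k) * Q * (H * F ^ k)ᵀ).PosSemidef := fun k => by
    simpa using hQ.mul_mul_conjTranspose_same (H * F ^ k)
  -- Traces turn the matrix series into a series of nonnegative reals with sum zero, and a positive
  -- semidefinite matrix of trace zero is zero.
  have htr := h.map (Matrix.traceAddMonoidHom κ ℝ) continuous_id.matrix_trace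
  rw [map_zero] at htr
  have h1 := (hasSum_zero_iff_of_nonneg fun k => (hpsd k).trace_nonneg).1 htr
  exact mul_eq_zero_of_posSemidef hQ ((hpsd k).trace_eq_zero_iff.1 (congrFun h1 k))

variable {F : Matrix ι ι ℝ} {X η : ℕ → ι → ℝ}

/-- Covers both one-step maps: x ↦ F x on states (`m = 1`) and M ↦ F M Fᵀ on covariances (`m = 2`).
-/
theorem IsStable.exists_gauge {E : Type*} [NormedAddCommGroup E] [NormedSpace ℝ E]
    [FiniteDimensional ℝ E] (hF : IsStable F) (T : E →ₗ[ℝ] E) {m : ℕ} (hm : 0 < m)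
    (hT : ∀ k x, ‖(T ^ k) x‖ ≤ ‖F ^ k‖ ^ m * ‖x‖) :
    ∃ (r : ℝ) (g : E → ℝ) (c : ℝ), 0 < r ∧ r < 1 ∧ (∀ x, ‖x‖ ≤ g x) ∧ (∀ x, g x ≤ c * ‖x‖) ∧
      (∀ x y, g (x + y) ≤ g x + g y) ∧ ∀ x, g (T x) ≤ r * g x := by
  obtain ⟨r, hr0, hr1, hr⟩ := hF
  obtain ⟨k, hk, hk0⟩ := (hr.and (eventually_gt_atTop 0)).exists
  obtain ⟨g, c, h1, h2, h3, h4⟩ := exists_contracting_gauge T hr0 (b := ‖F‖ ^ m)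
    (fun x => by simpa using hT 1 x) hk0 fun x => (hT k x).trans <| by
      gcongr
      calc ‖F ^ k‖ ^ m ≤ (r ^ k) ^ m := by gcongr
        _ ≤ (r ^ k) ^ 1 := pow_le_pow_of_le_one (by positivity) (pow_le_one₀ hr0.le hr1.le) hm
        _ = r ^ k := pow_one _
  exact ⟨r, g, c, hr0, hr1, h1, h2, h3, h4⟩

/-- A stable system driven by an input of bounded power has a state of bounded power. -/
theorem IsStable.powerBounded (hF : IsStable F) (hX : ∀ n, X (n + 1) = F *ᵥ X n + η n)
    (hη : PowerBounded η) : PowerBounded X := by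
  -- Vectors are treated as one-column matrices, so that the Frobenius norm is Euclidean and
  -- compatible with the norm of `F ^ k`.
  have hnorm : ∀ v : ι → ℝ, ‖Matrix.replicateCol Unit v‖ ^ 2 = ∑ i, v i ^ 2 := fun v => by
    rw [Matrix.frobenius_norm_replicateCol, EuclideanSpace.norm_sq_eq]
    simp
  set T : Matrix ι Unit ℝ →ₗ[ℝ] Matrix ι Unit ℝ :=
    ⟨⟨fun x => F * x, Matrix.mul_add F⟩, fun a x => Matrix.mul_smul F a x⟩ with hTdef
  have hT : ∀ k x, (T ^ k) x = F ^ k * x := by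
    intro k x
    induction k with
    | zero => simp
    | succ k ih => rw [pow_succ', Module.End.mul_apply, ih, pow_succ', Matrix.mul_assoc]; rfl
  obtain ⟨r, g, c, hr0, hr1, h1, h2, h3, h4⟩ := hF.exists_gauge T one_pos fun k x => by
    rw [hT, pow_one]
    exact Matrix.frobenius_norm_mul _ _
  have hg0 : ∀ x, 0 ≤ g x := fun x => (norm_nonneg x).trans (h1 x)
  obtain ⟨d, hd⟩ := sum_sq_le_of_contraction (a := fun n => g (Matrix.replicateCol Unit (X n)))
    (b := fun n => g (Matrix.replicateCol Unit (η n))) hr0.le hr1 (fun n => hg0 _)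
    (fun n => by
      have : Matrix.replicateCol Unit (X (n + 1))
          = T (Matrix.replicateCol Unit (X n)) + Matrix.replicateCol Unit (η n) := by
        rw [hX]
        ext i j
        simp [hTdef, Matrix.mul_apply, Matrix.mulVec, dotProduct]
      rw [this]
      exact (h3 _ _).trans (by gcongr; exact h4 _))
    (by
      choose e he using hη
      refine ⟨c ^ 2 * ∑ i, e i, fun N => ?_⟩
      calc ∑ n ∈ Finset.range N, g (Matrix.replicateCol Unit (η n)) ^ 2
          ≤ ∑ n ∈ Finset.range N, c ^ 2 * ∑ i, η n i ^ 2 := by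
            refine Finset.sum_le_sum fun n _ => ?_
            rw [← hnorm, ← mul_pow]
            exact pow_le_pow_left₀ (hg0 _) (h2 _) 2
        _ = c ^ 2 * ∑ i, ∑ n ∈ Finset.range N, η n i ^ 2 := by
            rw [← Finset.mul_sum, Finset.sum_comm]
        _ ≤ c ^ 2 * ∑ i, e i * N := by
            gcongr with i
            exact he i N
        _ = _ := by rw [← Finset.sum_mul, mul_assoc])
  intro i
  refine ⟨d, fun N => (Finset.sum_le_sum fun n _ => ?_).trans (hd N)⟩
  calc X n i ^ 2 ≤ ∑ i, X n i ^ 2 :=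
        Finset.single_le_sum (f := fun i => X n i ^ 2) (fun i _ => sq_nonneg _) (Finset.mem_univ i)
    _ = ‖Matrix.replicateCol Unit (X n)‖ ^ 2 := (hnorm _).symm
    _ ≤ _ := pow_le_pow_left₀ (norm_nonneg _) (h1 _) 2

/-- The empirical covariance of the state of a stable system driven by noise which is
asymptotically uncorrelated with the state converges to the stationary covariance. -/
theorem IsStable.avgCov (hF : IsStable F) (hX : ∀ n, X (n + 1) = F *ᵥ X n + η n)
    {Q : Matrix ι ι ℝ} (hη : AvgCov η η Q) (hXη : AvgCov X η 0) :
    AvgCov X X (stationaryCov F Q) := by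
  set S := stationaryCov F Q with hSdef
  have hS : S = F * S * Fᵀ + Q := stationaryCov_eq hF Q
  set T : Matrix ι ι ℝ →ₗ[ℝ] Matrix ι ι ℝ :=
    ⟨⟨fun M => F * M * Fᵀ, fun M N => by noncomm_ring⟩, fun a M => by simp⟩ with hTdef
  have hT : ∀ k x, (T ^ k) x = F ^ k * x * (F ^ k)ᵀ := by
    intro k x
    induction k with
    | zero => simp
    | succ k ih =>
      rw [pow_succ', Module.End.mul_apply, ih, pow_succ', Matrix.transpose_mul]
      simp only [hTdef, LinearMap.coe_mk, AddHom.coe_mk]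
      noncomm_ring
  obtain ⟨r, g, c, hr0, hr1, h1, h2, h3, h4⟩ := hF.exists_gauge T two_pos fun k x => by
    rw [hT]
    calc _ ≤ ‖F ^ k‖ * ‖x‖ * ‖(F ^ k)ᵀ‖ :=
          (norm_mul_le _ _).trans (by gcongr; exact norm_mul_le _ _)
      _ = _ := by rw [Matrix.frobenius_norm_transpose]; ring
  have hg0 : ∀ x, 0 ≤ g x := fun x => (norm_nonneg x).trans (h1 x)
  set V : (ℕ → ι → ℝ) → (ℕ → ι → ℝ) → ℕ → Matrix ι ι ℝ := fun a b N =>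
    ∑ n ∈ Finset.range N, Matrix.vecMulVec (a n) (b n) with hV
  have hVlim : ∀ {a b M}, AvgCov a b M →
      Tendsto (fun N : ℕ => (1 / (N : ℝ)) • V a b N) atTop (𝓝 M) := fun {a b M} h =>
    tendsto_pi_nhds.2 fun i => tendsto_pi_nhds.2 fun j => by
      simpa [hV, Matrix.sum_apply, Matrix.vecMulVec_apply] using h i j
  have hZ : AvgCov (fun n => X (n + 1)) (fun n => X (n + 1)) S ↔ AvgCov X X S :=
    AvgCov.comp_add_iff 1
  set R : ℕ → Matrix ι ι ℝ := fun N =>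
    V (fun n => F *ᵥ X n) η N + V η (fun n => F *ᵥ X n) N + V η η N with hR
  have hRlim : Tendsto (fun N : ℕ => (1 / (N : ℝ)) • R N) atTop (𝓝 Q) := by
    have e1 := hVlim (hXη.mulVec_left F)
    have e2 := hVlim (hXη.mulVec_left F).swap
    have := (e1.add e2).add (hVlim hη)
    simpa [hR, smul_add] using this
  -- The unnormalized deviation satisfies D (N + 1) = T (D N) + W N, where `W N` is o(N): `R N`
  -- collects the cross and noise terms, and the rest is a constant from the start. The contraction
  -- then gives D N = o(N).
  set D : ℕ → Matrix ι ι ℝ := fun N => V X X N - (N : ℝ) • S with hD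
  set W : ℕ → Matrix ι ι ℝ := fun N => R N - (N : ℝ) • Q + (Matrix.vecMulVec (X 0) (X 0) - S)
    with hW
  have hrec : ∀ N, D (N + 1) = T (D N) + W N := by
    intro N
    have e1 : V X X (N + 1) = F * V X X N * Fᵀ + R N + Matrix.vecMulVec (X 0) (X 0) := by
      simp only [hV, hR, Finset.sum_range_succ']
      rw [Finset.mul_sum, Finset.sum_mul, ← Finset.sum_add_distrib, ← Finset.sum_add_distrib,
        ← Finset.sum_add_distrib]
      congr 1
      refine Finset.sum_congr rfl fun n _ => ?_
      rw [hX, Matrix.mul_vecMulVec, Matrix.vecMulVec_mul, Matrix.vecMul_transpose]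
      simp only [Matrix.add_vecMulVec, Matrix.vecMulVec_add]
      abel
    simp only [hD, hW, hTdef, LinearMap.coe_mk, AddHom.coe_mk, e1]
    have e2 : ((N + 1 : ℕ) : ℝ) • S = F * ((N : ℝ) • S) * Fᵀ + (N : ℝ) • Q + S := by
      push_cast
      rw [add_smul, one_smul, Matrix.mul_smul, Matrix.smul_mul, ← smul_add, ← hS]
    rw [e2, Matrix.mul_sub, Matrix.sub_mul]
    abel
  have hinv : Tendsto (fun N : ℕ => ((N : ℝ) + 1)⁻¹) atTop (𝓝 0) := by
    simpa using tendsto_one_div_add_atTop_nhds_zero_nat (𝕜 := ℝ)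
  have hWlim : Tendsto (fun N : ℕ => g (W N) / ((N : ℝ) + 1)) atTop (𝓝 0) := by
    have hq : Tendsto (fun N : ℕ => (N : ℝ) / (N + 1)) atTop (𝓝 1) :=
      tendsto_natCast_div_add_atTop 1
    have l1 : Tendsto (fun N : ℕ => ((N : ℝ) + 1)⁻¹ • W N) atTop (𝓝 0) := by
      have l2 := (hq.smul (hRlim.sub_const Q)).add
        (hinv.smul_const (Matrix.vecMulVec (X 0) (X 0) - S))
      simp only [sub_self, smul_zero, zero_smul, add_zero] at l2
      refine l2.congr' ?_
      filter_upwards [eventually_gt_atTop 0] with N hN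
      have : (N : ℝ) ≠ 0 := by positivity
      have : (N : ℝ) + 1 ≠ 0 := by positivity
      simp only [hW, smul_sub, smul_add, smul_smul]
      congr 3 <;> field_simp
    have l3 := (l1.norm.const_mul c)
    rw [norm_zero, mul_zero] at l3
    refine squeeze_zero (fun N => div_nonneg (hg0 _) (by positivity)) (fun N => ?_) l3
    rw [norm_smul, Real.norm_of_nonneg (by positivity), div_eq_inv_mul, mul_left_comm]
    gcongr
    exact h2 _
  have hDlim := tendsto_div_zero_of_contraction (a := fun N => g (D N)) (b := fun N => g (W N))
    hr0.le hr1 (fun N => hg0 _) (fun N => hg0 _)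
    (fun N => by rw [hrec]; exact (h3 _ _).trans (by gcongr; exact h4 _)) hWlim
  have l4 : Tendsto (fun N : ℕ => ((N : ℝ) + 1)⁻¹ • D N) atTop (𝓝 0) := by
    refine squeeze_zero_norm (fun N => ?_) hDlim
    rw [norm_smul, Real.norm_of_nonneg (by positivity), div_eq_inv_mul]
    gcongr
    exact h1 _
  have l5 : Tendsto (fun N : ℕ => (1 / (N : ℝ)) • V X X N) atTop (𝓝 S) := by
    have hq : Tendsto (fun N : ℕ => ((N : ℝ) + 1) / N) atTop (𝓝 1) := by
      have := (tendsto_natCast_div_add_atTop (1 : ℝ)).inv₀ one_ne_zero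
      simpa using this
    have l6 := (hq.smul l4).add_const S
    simp only [smul_zero, zero_add] at l6
    refine l6.congr' ?_
    filter_upwards [eventually_gt_atTop 0] with N hN
    have h5 : (N : ℝ) ≠ 0 := by positivity
    have : (N : ℝ) + 1 ≠ 0 := by positivity
    rw [smul_smul, show ((N : ℝ) + 1) / N * ((N : ℝ) + 1)⁻¹ = 1 / N by field_simp]
    simp only [hD, smul_sub, smul_smul, one_div_mul_cancel h5, one_smul, sub_add_cancel]
  intro i j
  have := tendsto_pi_nhds.1 (tendsto_pi_nhds.1 l5 i) j
  simpa [hV, Matrix.sum_apply, Matrix.vecMulVec_apply] using this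

end Stable

variable {p q m : ℕ} {Ω : Type*}

/-! ### The relative degree -/

/-- Cayley–Hamilton: `A ^ k` is a polynomial in `A` of degree less than `p`. -/
theorem mul_pow_mul_eq_zero_of_lt {A : Matrix (Fin p) (Fin p) ℝ} {B : Matrix (Fin p) (Fin q) ℝ}
    {C : Matrix (Fin m) (Fin p) ℝ} (hp : 0 < p) (h : ∀ k < p, C * A ^ k * B = 0) (k : ℕ) :
    C * A ^ k * B = 0 := by
  have : Nontrivial (Matrix (Fin p) (Fin p) ℝ) := by
    have : Nonempty (Fin p) := ⟨⟨0, hp⟩⟩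
    infer_instance
  have hdeg : (Polynomial.X ^ k %ₘ A.charpoly).natDegree < p := by
    have h1 := Polynomial.natDegree_modByMonic_lt (Polynomial.X ^ k) A.charpoly_monic
      (fun h => by have := A.charpoly_natDegree_eq_dim; rw [h] at this; simp at this; omega)
    rwa [A.charpoly_natDegree_eq_dim, Fintype.card_fin] at h1
  rw [Matrix.pow_eq_aeval_mod_charpoly, Polynomial.aeval_eq_sum_range' hdeg, Matrix.mul_sum,
    Matrix.sum_mul]
  refine Finset.sum_eq_zero fun j hj => ?_
  rw [Matrix.mul_smul, Matrix.smul_mul, h j (Finset.mem_range.1 hj), smul_zero]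

/-- For a controllable and observable plant some Markov parameter of index less than `p` of the
closed loop is nonzero. -/
theorem exists_markov_ne_zero (hp : 0 < p) (P : Plant p q m) (hctrl : IsControllable P.A P.B)
    (hobs : IsObservable P.A P.C) : ∃ k < p, P.C * (P.A + P.B * P.K) ^ k * P.B ≠ 0 := by
  by_contra! h
  have hall := mul_pow_mul_eq_zero_of_lt hp h
  have hreach : ∀ (u : ℕ → Fin q → ℝ) (N k : ℕ),
      (P.C * (P.A + P.B * P.K) ^ k) *ᵥ stateAt P.A P.B 0 u N = 0 := by
    intro u N
    induction N with
    | zero => simp [stateAt]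
    | succ N ih =>
      intro k
      -- The same trajectory, read as one of the feedback system with input u - K x.
      have e : stateAt P.A P.B 0 u (N + 1) = (P.A + P.B * P.K) *ᵥ stateAt P.A P.B 0 u N
          + P.B *ᵥ (u N - P.K *ᵥ stateAt P.A P.B 0 u N) := by
        simp only [stateAt, Matrix.add_mulVec, Matrix.mulVec_sub, Matrix.mulVec_mulVec]
        abel
      rw [e, Matrix.mulVec_add, Matrix.mulVec_mulVec, Matrix.mulVec_mulVec, hall,
        Matrix.mul_assoc, ← pow_succ, ih, Matrix.zero_mulVec, add_zero]
  have hC : ∀ x, P.C *ᵥ x = 0 := fun x => by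
    obtain ⟨N, u, rfl⟩ := hctrl 0 x
    simpa using hreach u N 0
  have := congrFun (hobs 0 (Pi.single ⟨0, hp⟩ 1) fun n => by rw [hC, hC]) ⟨0, hp⟩
  simp at this

/-! ### Detecting the multiplicative part of the attack -/

theorem measurable_mulVec_comp [MeasurableSpace Ω] {k l : ℕ} (A : Matrix (Fin k) (Fin l) ℝ)
    {f : Ω → Fin l → ℝ} (hf : Measurable f) : Measurable fun t => A *ᵥ f t :=
  (continuous_const.matrix_mulVec continuous_id).measurable.comp hf

theorem Plant.residual_eq (P : Plant p q m) (α : ℝ) (η : Inputs p q m Ω) (n : ℕ) (t : Ω) :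
    P.residual α η n t = P.C *ᵥ ((P.loop α η t n).xhat - (P.loop α η t n).x) - η.z n t
      - P.attackOf α (P.loop α η t n) (η.z n t) (η.ζ n t) := by
  simp only [Plant.residual, Plant.outputOf, Matrix.mulVec_sub]
  abel

/-- The control, and with it the excitation, cancels: it can affect the observation error only
through the residual. -/
theorem Plant.loop_succ_sub (P : Plant p q m) (α : ℝ) (η : Inputs p q m Ω) (n : ℕ) (t : Ω) :
    (P.loop α η t (n + 1)).xhat - (P.loop α η t (n + 1)).x
      = P.A *ᵥ ((P.loop α η t n).xhat - (P.loop α η t n).x) + P.L *ᵥ P.residual α η n t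
        - η.w n t := by
  simp only [Plant.loop, Plant.residual, Matrix.mulVec_sub]
  abel

theorem Plant.loop_succ_x (P : Plant p q m) (α : ℝ) (η : Inputs p q m Ω) (n : ℕ) (t : Ω) :
    (P.loop α η t (n + 1)).x = (P.A + P.B * P.K) *ᵥ (P.loop α η t n).x
      + P.B *ᵥ P.K *ᵥ ((P.loop α η t n).xhat - (P.loop α η t n).x) + P.B *ᵥ η.e n t
      + η.w n t := by
  simp only [Plant.loop, Matrix.mulVec_sub, Matrix.mulVec_add, Matrix.add_mulVec,
    Matrix.mulVec_mulVec]
  abel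

theorem Plant.loop_succ_ξ (P : Plant p q m) (α : ℝ) (η : Inputs p q m Ω) (n : ℕ) (t : Ω) :
    (P.loop α η t (n + 1)).ξ = (P.A + P.B * P.K) *ᵥ (P.loop α η t n).ξ + η.o n t := rfl

theorem Plant.measurable_loop [MeasurableSpace Ω] (P : Plant p q m) (α : ℝ) {η : Inputs p q m Ω}
    (hx : Measurable η.x₀) (hxhat : Measurable η.xhat₀) (hξ : Measurable η.ξ₀)
    (hw : ∀ n, Measurable (η.w n)) (hz : ∀ n, Measurable (η.z n)) (he : ∀ n, Measurable (η.e n))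
    (ho : ∀ n, Measurable (η.o n)) (hζ : ∀ n, Measurable (η.ζ n)) (n : ℕ) :
    Measurable (fun t => (P.loop α η t n).x) ∧ Measurable (fun t => (P.loop α η t n).xhat) ∧
      Measurable (fun t => (P.loop α η t n).ξ) ∧ Measurable (P.residual α η n) := by
  have hres : ∀ n, Measurable (fun t => (P.loop α η t n).x) →
      Measurable (fun t => (P.loop α η t n).xhat) → Measurable (fun t => (P.loop α η t n).ξ) →
      Measurable (P.residual α η n) := fun n h1 h2 h3 => by
    have h4 := measurable_mulVec_comp P.C h1
    exact (measurable_mulVec_comp P.C h2).sub ((h4.add (hz n)).add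
      ((((h4.add (hz n)).const_smul α).add (measurable_mulVec_comp P.C h3)).add (hζ n)))
  induction n with
  | zero => exact ⟨hx, hxhat, hξ, hres 0 hx hxhat hξ⟩
  | succ n ih =>
    obtain ⟨h1, h2, h3, h4⟩ := ih
    have hu := measurable_mulVec_comp P.B ((measurable_mulVec_comp P.K h2).add (he n))
    have g1 : Measurable fun t => (P.loop α η t (n + 1)).x :=
      ((measurable_mulVec_comp P.A h1).add hu).add (hw n)
    have g2 : Measurable fun t => (P.loop α η t (n + 1)).xhat :=
      ((measurable_mulVec_comp P.A h2).add hu).add (measurable_mulVec_comp P.L h4)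
    have g3 : Measurable fun t => (P.loop α η t (n + 1)).ξ :=
      (measurable_mulVec_comp (P.A + P.B * P.K) h3).add (ho n)
    exact ⟨g1, g2, g3, hres _ g1 g2 g3⟩

/-- The inputs with the private excitation switched off from time `J` on. -/
def Inputs.truncate (η : Inputs p q m Ω) (J : ℕ) : Inputs p q m Ω :=
  { η with e := fun n t => if n < J then η.e n t else 0 }

theorem Plant.loop_truncate (P : Plant p q m) (α : ℝ) (η : Inputs p q m Ω) (J : ℕ) (t : Ω)
    {n : ℕ} (hn : n ≤ J) : P.loop α (η.truncate J) t n = P.loop α η t n := by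
  induction n with
  | zero => rfl
  | succ n ih =>
    have h : n < J := hn
    simp only [Plant.loop, ih h.le]
    simp [Inputs.truncate, h]

/-- Up to the relative degree the excitation at time `J` reaches the residual only through the
multiplicative part of the attack. -/
theorem Plant.residual_truncate (P : Plant p q m) (α : ℝ) (η : Inputs p q m Ω) (J : ℕ) (t : Ω)
    {k : ℕ} (hk : ∀ l < k, P.C * (P.A + P.B * P.K) ^ l * P.B = 0) :
    P.residual α (η.truncate J) (J + (k + 1)) t = P.residual α η (J + (k + 1)) t
      + (α • (P.C * (P.A + P.B * P.K) ^ k * P.B)) *ᵥ η.e J t := by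
  set η' := η.truncate J with hη'
  set F := P.A + P.B * P.K with hF
  have hres : ∀ n, (P.loop α η' t n).xhat - (P.loop α η' t n).x
      = (P.loop α η t n).xhat - (P.loop α η t n).x →
      (P.loop α η' t n).ξ = (P.loop α η t n).ξ →
      P.residual α η' n t = P.residual α η n t
        + α • (P.C *ᵥ ((P.loop α η t n).x - (P.loop α η' t n).x)) := fun n h1 h2 => by
    have h3 : η'.z n t = η.z n t := rfl
    have h4 : η'.ζ n t = η.ζ n t := rfl
    rw [P.residual_eq, P.residual_eq, h1]
    simp only [Plant.attackOf, h2, h3, h4, Matrix.mulVec_sub, smul_sub, smul_add]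
    abel
  -- Both runs share observation error and false state up to time J + k + 1. Their plant states,
  -- seen through C F^l with l + i ≤ k, differ only by the response to e_J, since later excitations
  -- enter with C F^l B, l < k.
  have key : ∀ i ≤ k, (P.loop α η' t (J + (i + 1))).xhat - (P.loop α η' t (J + (i + 1))).x
        = (P.loop α η t (J + (i + 1))).xhat - (P.loop α η t (J + (i + 1))).x ∧
      (P.loop α η' t (J + (i + 1))).ξ = (P.loop α η t (J + (i + 1))).ξ ∧
      ∀ l, l + i ≤ k → (P.C * F ^ l) *ᵥ
        ((P.loop α η t (J + (i + 1))).x - (P.loop α η' t (J + (i + 1))).x)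
          = (P.C * F ^ (l + i) * P.B) *ᵥ η.e J t := by
    intro i
    induction i with
    | zero =>
      intro _
      have h0 : P.loop α η' t J = P.loop α η t J := P.loop_truncate α η J t le_rfl
      have hr : P.residual α η' J t = P.residual α η J t := by
        simp only [Plant.residual, h0]; rfl
      have he : η'.e J t = 0 := by simp [hη', Inputs.truncate]
      have hw : η'.w J t = η.w J t := rfl
      have ho : η'.o J t = η.o J t := rfl
      refine ⟨?_, ?_, fun l _ => ?_⟩
      · rw [zero_add, P.loop_succ_sub, P.loop_succ_sub, h0, hr, hw]
      · rw [zero_add, P.loop_succ_ξ, P.loop_succ_ξ, h0, ho]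
      · have e : (P.loop α η t (J + 1)).x - (P.loop α η' t (J + 1)).x = P.B *ᵥ η.e J t := by
          rw [P.loop_succ_x, P.loop_succ_x, h0, he, hw, Matrix.mulVec_zero]
          abel
        rw [zero_add, e, Matrix.mulVec_mulVec, add_zero]
    | succ i ih =>
      intro hi
      obtain ⟨h1, h2, h3⟩ := ih (by omega)
      have hw : η'.w (J + (i + 1)) t = η.w (J + (i + 1)) t := rfl
      have ho : η'.o (J + (i + 1)) t = η.o (J + (i + 1)) t := rfl
      have he : η'.e (J + (i + 1)) t = 0 := by simp [hη', Inputs.truncate]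
      -- Before the relative degree is reached the plant outputs agree, hence so do the residuals
      -- and the next observation errors.
      have hC := h3 0 (by omega)
      rw [zero_add, hk i (by omega), pow_zero, Matrix.mul_one, Matrix.zero_mulVec] at hC
      have hr := hres _ h1 h2
      rw [hC, smul_zero, add_zero] at hr
      refine ⟨?_, ?_, fun l hl => ?_⟩
      · rw [← add_assoc, P.loop_succ_sub, P.loop_succ_sub, h1, hr, hw]
      · rw [← add_assoc J, P.loop_succ_ξ, P.loop_succ_ξ, h2, ho]
      · have e : (P.loop α η t (J + (i + 1) + 1)).x - (P.loop α η' t (J + (i + 1) + 1)).x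
            = F *ᵥ ((P.loop α η t (J + (i + 1))).x - (P.loop α η' t (J + (i + 1))).x)
              + P.B *ᵥ η.e (J + (i + 1)) t := by
          rw [P.loop_succ_x, P.loop_succ_x, h1, he, hw, Matrix.mulVec_zero, Matrix.mulVec_sub F]
          abel
        rw [← add_assoc J, e, Matrix.mulVec_add, Matrix.mulVec_mulVec, Matrix.mulVec_mulVec,
          hk l (by omega), Matrix.zero_mulVec, add_zero, Matrix.mul_assoc P.C, ← pow_succ,
          h3 (l + 1) (by omega), add_right_comm l 1 i, add_assoc]
  obtain ⟨h1, h2, h3⟩ := key k le_rfl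
  have h4 := h3 0 (by omega)
  rw [pow_zero, Matrix.mul_one, zero_add] at h4
  rw [hres _ h1 h2, h4, Matrix.smul_mulVec]

theorem AvgTendsto.avgCov [MeasurableSpace Ω] {μ : Measure Ω} {k l : ℕ}
    {a : ℕ → Ω → Fin k → ℝ} {b : ℕ → Ω → Fin l → ℝ} {M : Matrix (Fin k) (Fin l) ℝ}
    (h : AvgTendsto μ (fun n t => Matrix.vecMulVec (a n t) (b n t)) M) :
    ∀ᵐ t ∂μ, AvgCov (fun n => a n t) (fun n => b n t) M := by
  filter_upwards [h] with t ht i j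
  have := tendsto_pi_nhds.1 (tendsto_pi_nhds.1 ht i) j
  simpa [Matrix.sum_apply, Matrix.vecMulVec_apply] using this

section Admissible

variable [MeasurableSpace Ω] {μ : Measure Ω}
  {SW : Matrix (Fin p) (Fin p) ℝ} {SZ : Matrix (Fin m) (Fin m) ℝ} {SE : Matrix (Fin q) (Fin q) ℝ}
  {SO : Matrix (Fin p) (Fin p) ℝ} {SS : Matrix (Fin m) (Fin m) ℝ} {η : Inputs p q m Ω}

theorem Plant.measurable_residual_truncate (P : Plant p q m) (α : ℝ)
    (hη : η.IsAdmissible μ SW SZ SE SO SS) (J n : ℕ) :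
    Measurable[pastFiltration hη.measurable Source.e J] (P.residual α (η.truncate J) n) := by
  have hs : Measurable[pastFiltration hη.measurable Source.e J] (η.source .start) :=
    measurable_pastFiltration hη.measurable (by simp)
  refine (@Plant.measurable_loop p q m Ω (pastFiltration hη.measurable Source.e J) P α
    (η.truncate J) (measurable_fst.comp hs) (measurable_fst.comp (measurable_snd.comp hs))
    (measurable_snd.comp (measurable_snd.comp hs))
    (fun k => measurable_pastFiltration hη.measurable (i := .w k) (by simp))
    (fun k => measurable_pastFiltration hη.measurable (i := .z k) (by simp))
    (fun k => ?_)
    (fun k => measurable_pastFiltration hη.measurable (i := .o k) (by simp))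
    (fun k => measurable_pastFiltration hη.measurable (i := .ζ k) (by simp)) n).2.2.2
  by_cases hk : k < J
  · simp only [Inputs.truncate, hk, if_true]
    exact measurable_pastFiltration hη.measurable (i := .e k) (by simp; omega)
  · simp only [Inputs.truncate, hk, if_false]
    exact measurable_const

variable [IsProbabilityMeasure μ]

/-- An attack that passes both tests has no multiplicative part. -/
theorem Plant.PassesTests.gain_eq_zero {P : Plant p q m} {α : ℝ} {k : ℕ}
    (h : P.PassesTests μ α η SW SZ k) (hη : η.IsAdmissible μ SW SZ SE SO SS) (hSE : SE.rank = q)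
    (hk : IsLeast {k : ℕ | P.C * (P.A + P.B * P.K) ^ k * P.B ≠ 0} k) : α = 0 := by
  set M := P.C * (P.A + P.B * P.K) ^ k * P.B with hM
  have hlt : ∀ l < k, P.C * (P.A + P.B * P.K) ^ l * P.B = 0 := fun l hl => by
    by_contra hne
    exact absurd (hk.2 hne) (by omega)
  have hinj : Function.Injective Source.e := fun _ _ h => Source.e.inj h
  have hem : ∀ n, Measurable[MeasurableSpace.comap (η.source (.e n)) inferInstance] (η.e n) :=
    fun n => comap_measurable (η.source (.e n))
  have hee := ae_avgCov_noise hη.indep hinj hem hη.e_law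
  have hrr := h.1.avgCov
  have hres := fun n t => P.residual_truncate α η n t hlt
  -- For general `α` the loop may be unstable; the power bound on the residual comes from the first
  -- test itself.
  have hse := ae_avgCov_zero hη.measurable hη.indep hinj hem hη.e_law
    (s := fun n => P.residual α (η.truncate n) (n + (k + 1)))
    (fun n => P.measurable_residual_truncate α hη n _) (by
      filter_upwards [hee, hrr] with t hee hrr
      simp only [hres]
      exact (hrr.powerBounded.comp_add (k + 1)).add (hee.powerBounded.mulVec _))
  obtain ⟨t, hee, hse, hre⟩ := (hee.and (hse.and h.2.avgCov)).exists
  -- Shifting the second test by k + 1 discards the terms where the delayed excitation is 0 by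
  -- convention.
  have hre' : AvgCov (fun n => P.residual α η (n + (k + 1)) t) (fun n => η.e n t) 0 := by
    have := (AvgCov.comp_add_iff (k + 1)).2 hre
    simpa [Inputs.delayedExcitation] using this
  have h1 := (hre'.add_left (hee.mulVec_left (α • M)))
  simp only [hres] at hse
  have h2 := h1.unique hse
  rw [zero_add] at h2
  have hu : IsUnit SE.det := by
    rw [← Matrix.isUnit_iff_isUnit_det]
    have htop : LinearMap.range SE.mulVecLin = ⊤ :=
      Submodule.eq_top_of_finrank_eq (by simpa [Matrix.rank] using hSE)
    exact Matrix.mulVec_surjective_iff_isUnit.1 (LinearMap.range_eq_top.1 htop)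
  have h3 : α • M = 0 := by
    have := congrArg (· * SE⁻¹) h2
    simpa [Matrix.mul_assoc, Matrix.mul_nonsing_inv _ hu] using this
  exact (smul_eq_zero.1 h3).resolve_right hk.1

end Admissible

/-! ### The additive part of the attack -/

/-- The system matrix of the joint evolution of the observation error and the false state. -/
def Plant.errorMatrix (P : Plant p q m) : Matrix (Fin p ⊕ Fin p) (Fin p ⊕ Fin p) ℝ :=
  Matrix.fromBlocks (P.A + P.L * P.C) (-(P.L * P.C)) 0 (P.A + P.B * P.K)

/-- The output matrix giving the residual in terms of `Plant.error`. -/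
def Plant.residualMatrix (P : Plant p q m) : Matrix (Fin m) (Fin p ⊕ Fin p) ℝ :=
  Matrix.fromCols P.C (-P.C)

/-- The output matrix giving the attack in terms of `Plant.error`. -/
def Plant.attackMatrix (P : Plant p q m) : Matrix (Fin m) (Fin p ⊕ Fin p) ℝ :=
  Matrix.fromCols 0 P.C

/-- The observation error stacked on the false state. -/
def Plant.error (P : Plant p q m) (η : Inputs p q m Ω) (n : ℕ) (t : Ω) : Fin p ⊕ Fin p → ℝ :=
  Sum.elim ((P.loop 0 η t n).xhat - (P.loop 0 η t n).x) (P.loop 0 η t n).ξ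

/-- The noise driving `Plant.error`. -/
def Plant.errorNoise (P : Plant p q m) (η : Inputs p q m Ω) (n : ℕ) (t : Ω) : Fin p ⊕ Fin p → ℝ :=
  Sum.elim (-(η.w n t + P.L *ᵥ (η.z n t + η.ζ n t))) (η.o n t)

theorem Plant.residual_zero_eq (P : Plant p q m) (η : Inputs p q m Ω) (n : ℕ) (t : Ω) :
    P.residual 0 η n t
      = P.residualMatrix *ᵥ P.error η n t + -(η.z n t + η.ζ n t) := by
  rw [P.residual_eq, Plant.error, Plant.residualMatrix, Matrix.fromCols_mulVec]
  simp only [Plant.attackOf, zero_smul, Sum.elim_comp_inl, Sum.elim_comp_inr, Matrix.neg_mulVec]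
  abel

theorem Plant.attack_zero_eq (P : Plant p q m) (η : Inputs p q m Ω) (n : ℕ) (t : Ω) :
    P.attack 0 η n t = P.attackMatrix *ᵥ P.error η n t + η.ζ n t := by
  rw [Plant.error, Plant.attackMatrix, Matrix.fromCols_mulVec]
  simp [Plant.attack, Plant.attackOf]

theorem Plant.error_succ (P : Plant p q m) (η : Inputs p q m Ω) (n : ℕ) (t : Ω) :
    P.error η (n + 1) t = P.errorMatrix *ᵥ P.error η n t + P.errorNoise η n t := by
  rw [Plant.error, P.loop_succ_sub, P.loop_succ_ξ, P.residual_eq, Plant.error, Plant.errorMatrix,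
    Plant.errorNoise, Matrix.fromBlocks_mulVec, ← Sum.elim_add_add]
  simp only [Plant.attackOf, zero_smul, Sum.elim_comp_inl, Sum.elim_comp_inr, Matrix.neg_mulVec,
    Matrix.zero_mulVec, Matrix.mulVec_zero, Matrix.add_mulVec, Matrix.mulVec_sub,
    Matrix.mulVec_add, Matrix.mulVec_mulVec]
  congr 1 <;> abel

/-! ### Stationary covariances of the residual and of the attack. -/

section Covariance

variable {SW SO : Matrix (Fin p) (Fin p) ℝ} {SZ SS : Matrix (Fin m) (Fin m) ℝ}

/-- The covariance of `Plant.errorNoise`. -/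
def Plant.errorNoiseCov (P : Plant p q m) (SW : Matrix (Fin p) (Fin p) ℝ)
    (SZ : Matrix (Fin m) (Fin m) ℝ) (SO : Matrix (Fin p) (Fin p) ℝ)
    (SS : Matrix (Fin m) (Fin m) ℝ) : Matrix (Fin p ⊕ Fin p) (Fin p ⊕ Fin p) ℝ :=
  Matrix.fromBlocks (SW + P.L * (SZ + SS) * P.Lᵀ) 0 0 SO

theorem stationaryCov_posSemidef {ι : Type*} [Fintype ι] [DecidableEq ι] {F Q : Matrix ι ι ℝ}
    (hF : IsStable F) (hQ : Q.PosSemidef) : (stationaryCov F Q).PosSemidef := by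
  have hterm : ∀ k : ℕ, (F ^ k * Q * (F ^ k)ᵀ).PosSemidef := fun k => by
    simpa using hQ.mul_mul_conjTranspose_same (F ^ k)
  refine Matrix.posSemidef_iff_dotProduct_mulVec.2 ⟨?_, fun x => ?_⟩
  · rw [Matrix.IsHermitian, stationaryCov, Matrix.conjTranspose_tsum]
    exact tsum_congr fun k => (hterm k).1
  · have hc : Continuous fun M : Matrix ι ι ℝ => star x ⬝ᵥ (M *ᵥ x) := by
      fun_prop
    have hlim := (hc.tendsto _).comp (hF.summable Q).hasSum
    refine ge_of_tendsto' hlim fun s => ?_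
    exact (Matrix.posSemidef_iff_dotProduct_mulVec.1
      (Matrix.posSemidef_sum s fun k _ => hterm k)).2 x

theorem Matrix.PosSemidef.fromBlocks_diagonal {ι κ : Type*} [Fintype ι] [Fintype κ]
    {M : Matrix ι ι ℝ} {N : Matrix κ κ ℝ} (hM : M.PosSemidef) (hN : N.PosSemidef) :
    (Matrix.fromBlocks M 0 0 N).PosSemidef := by
  refine Matrix.posSemidef_iff_dotProduct_mulVec.2 ⟨?_, fun x => ?_⟩
  · rw [Matrix.IsHermitian, Matrix.fromBlocks_conjTranspose, hM.1.eq, hN.1.eq]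
    simp
  · have h1 := (Matrix.posSemidef_iff_dotProduct_mulVec.1 hM).2 (x ∘ Sum.inl)
    have h2 := (Matrix.posSemidef_iff_dotProduct_mulVec.1 hN).2 (x ∘ Sum.inr)
    rw [Matrix.fromBlocks_mulVec, ← Sum.elim_comp_inl_inr (star x), sumElim_dotProduct_sumElim]
    simpa using add_nonneg h1 h2

/-- If the residual has its nominal covariance then the additive attack has zero covariance. -/
theorem Plant.attackCov_eq_zero (P : Plant p q m) (hK : IsSchurStable (P.A + P.B * P.K))
    (hL : IsSchurStable (P.A + P.L * P.C)) (hSW : SW.PosSemidef) (hSZ : SZ.PosSemidef)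
    (hSO : SO.PosSemidef) (hSS : SS.PosSemidef)
    (h : P.residualMatrix
        * stationaryCov P.errorMatrix (P.errorNoiseCov SW SZ SO SS)
        * P.residualMatrixᵀ + (SZ + SS) = P.C * P.errorCov SW SZ * P.Cᵀ + SZ) :
    P.attackMatrix * stationaryCov P.errorMatrix (P.errorNoiseCov SW SZ SO SS)
      * P.attackMatrixᵀ + SS = 0 := by
  have hst : IsStable P.errorMatrix := hL.fromBlocks hK _
  set H := P.residualMatrix with hH
  -- `Q₁` is the noise present without attack, `Q₂` the attacker's contribution.
  set Q₁ : Matrix (Fin p ⊕ Fin p) (Fin p ⊕ Fin p) ℝ :=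
    Matrix.fromBlocks (SW + P.L * SZ * P.Lᵀ) 0 0 0 with hQ₁
  set Q₂ : Matrix (Fin p ⊕ Fin p) (Fin p ⊕ Fin p) ℝ :=
    Matrix.fromBlocks (P.L * SS * P.Lᵀ) 0 0 SO with hQ₂
  have hQ : P.errorNoiseCov SW SZ SO SS = Q₁ + Q₂ := by
    rw [hQ₁, hQ₂, Matrix.fromBlocks_add, Plant.errorNoiseCov, Matrix.mul_add, Matrix.add_mul]
    simp [add_assoc]
  have hLZ : (SW + P.L * SZ * P.Lᵀ).PosSemidef := by
    simpa using hSW.add (hSZ.mul_mul_conjTranspose_same P.L)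
  have hLS : (P.L * SS * P.Lᵀ).PosSemidef := by
    simpa using hSS.mul_mul_conjTranspose_same P.L
  have hQ₂p : Q₂.PosSemidef := Matrix.PosSemidef.fromBlocks_diagonal hLS hSO
  -- The nominal noise never excites the false state, so the nominal Lyapunov solution padded with
  -- zeros solves the joint equation.
  have h1 : stationaryCov P.errorMatrix Q₁ = Matrix.fromBlocks (P.errorCov SW SZ) 0 0 0 := by
    refine (eq_stationaryCov hst ?_).symm
    have := (lyapunovSolution_spec hL hLZ).2
    rw [Plant.errorMatrix, Matrix.fromBlocks_transpose, Matrix.fromBlocks_multiply,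
      Matrix.fromBlocks_multiply, hQ₁, Matrix.fromBlocks_add]
    simpa [Plant.errorCov] using this
  have h2 : H * stationaryCov P.errorMatrix Q₁ * Hᵀ = P.C * P.errorCov SW SZ * P.Cᵀ := by
    rw [h1, hH, Plant.residualMatrix, Matrix.transpose_fromCols, Matrix.fromCols_mul_fromBlocks,
      Matrix.fromCols_mul_fromRows]
    simp
  rw [hQ, stationaryCov_add hst, Matrix.mul_add, Matrix.add_mul, h2] at h
  have h3 : H * stationaryCov P.errorMatrix Q₂ * Hᵀ + SS = 0 := by
    have : P.C * P.errorCov SW SZ * P.Cᵀ + SZ + (H * stationaryCov P.errorMatrix Q₂ * Hᵀ + SS)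
        = P.C * P.errorCov SW SZ * P.Cᵀ + SZ := by
      conv_rhs => rw [← h]
      abel
    simpa using this
  have hps : (H * stationaryCov P.errorMatrix Q₂ * Hᵀ).PosSemidef := by
    simpa using (stationaryCov_posSemidef hst hQ₂p).mul_mul_conjTranspose_same H
  have h4 : SS = 0 := by
    have htr := congrArg Matrix.trace h3
    rw [Matrix.trace_add, Matrix.trace_zero] at htr
    exact hSS.trace_eq_zero_iff.1 (by linarith [hps.trace_nonneg, hSS.trace_nonneg])
  have h5 : H * stationaryCov P.errorMatrix Q₂ * Hᵀ = 0 := by simpa [h4] using h3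
  have h6 := mul_pow_mul_eq_zero hst hQ₂p h5
  set F := P.A + P.B * P.K with hF
  have hQ₂' : Q₂ = Matrix.fromBlocks 0 0 0 SO := by rw [hQ₂, h4]; simp
  have hker : ∀ M : Matrix (Fin p) (Fin p) ℝ,
      H * (Matrix.fromBlocks 0 0 0 M : Matrix (Fin p ⊕ Fin p) (Fin p ⊕ Fin p) ℝ) = 0 →
      P.C * M = 0 := fun M hM => by
    rw [hH, Plant.residualMatrix, Matrix.fromCols_mul_fromBlocks] at hM
    ext i j
    simpa using congrFun (congrFun hM i) (Sum.inr j)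
  -- The two outputs C · error and C ξ cannot cancel: while the error block is zero, a vanishing
  -- residual response gives C F^k Σ_O = 0, and then the coupling -LC keeps the error block zero at
  -- the next step.
  have h7 : ∀ k, P.errorMatrix ^ k * Q₂ = Matrix.fromBlocks 0 0 0 (F ^ k * SO) := by
    intro k
    induction k with
    | zero => simp [hQ₂']
    | succ k ih =>
      have h8 := hker _ (by rw [← ih, ← Matrix.mul_assoc, h6])
      rw [pow_succ', Matrix.mul_assoc, ih, Plant.errorMatrix, ← hF, Matrix.fromBlocks_multiply]
      simp [Matrix.mul_assoc, h8, pow_succ']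
  have h8 : ∀ k, P.C * (F ^ k * SO) = 0 := fun k => hker _ (by rw [← h7, ← Matrix.mul_assoc, h6])
  have h9 : ∀ k, P.attackMatrix * P.errorMatrix ^ k = Matrix.fromCols 0 (P.C * F ^ k) := by
    intro k
    induction k with
    | zero => simp [Plant.attackMatrix]
    | succ k ih =>
      rw [pow_succ, ← Matrix.mul_assoc, ih, Plant.errorMatrix, ← hF,
        Matrix.fromCols_mul_fromBlocks]
      simp [Matrix.mul_assoc, pow_succ]
  have h10 : ∀ k, P.attackMatrix * P.errorMatrix ^ k * (Q₁ + Q₂) = 0 := by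
    intro k
    rw [h9, hQ₁, hQ₂', Matrix.fromBlocks_add, Matrix.fromCols_mul_fromBlocks]
    simp [Matrix.mul_assoc, h8]
  have h12 := hasSum_mul_stationaryCov_mul hst (Q₁ + Q₂) P.attackMatrix
  simp only [h10, Matrix.zero_mul] at h12
  rw [hQ, h12.unique hasSum_zero, h4, add_zero]

end Covariance

theorem measurable_sumElim {mΩ : MeasurableSpace Ω} {ι κ : Type*} {f : Ω → ι → ℝ} {g : Ω → κ → ℝ}
    (hf : Measurable f) (hg : Measurable g) : Measurable fun t => Sum.elim (f t) (g t) := by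
  refine measurable_pi_lambda _ ?_
  rintro (i | i)
  · exact (measurable_pi_apply i).comp hf
  · exact (measurable_pi_apply i).comp hg

/-! ### Almost sure empirical covariances without multiplicative attack. -/

section Admissible

variable [MeasurableSpace Ω] {μ : Measure Ω}
  {SW : Matrix (Fin p) (Fin p) ℝ} {SZ : Matrix (Fin m) (Fin m) ℝ} {SE : Matrix (Fin q) (Fin q) ℝ}
  {SO : Matrix (Fin p) (Fin p) ℝ} {SS : Matrix (Fin m) (Fin m) ℝ} {η : Inputs p q m Ω}

/-- `Plant.error` at time `n` depends only on noises before time `n`. -/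
theorem Plant.measurable_error (P : Plant p q m) (hη : η.IsAdmissible μ SW SZ SE SO SS)
    {c : ℕ → Source} (hstart : ∀ j, Source.start ≠ c j) (hw : ∀ n j, n < j → Source.w n ≠ c j)
    (hz : ∀ n j, n < j → Source.z n ≠ c j) (ho : ∀ n j, n < j → Source.o n ≠ c j)
    (hζ : ∀ n j, n < j → Source.ζ n ≠ c j) (n : ℕ) :
    Measurable[pastFiltration hη.measurable c n] (P.error η n) := by
  induction n with
  | zero =>
    have hs : Measurable[pastFiltration hη.measurable c 0] (η.source .start) :=
      measurable_pastFiltration hη.measurable fun j _ => hstart j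
    exact measurable_sumElim ((measurable_fst.comp (measurable_snd.comp hs)).sub (measurable_fst.comp hs))
      (measurable_snd.comp (measurable_snd.comp hs))
  | succ n ih =>
    have gw : Measurable[pastFiltration hη.measurable c (n + 1)] (η.w n) :=
      measurable_pastFiltration hη.measurable (i := .w n) fun j hj => hw n j hj
    have gz : Measurable[pastFiltration hη.measurable c (n + 1)] (η.z n) :=
      measurable_pastFiltration hη.measurable (i := .z n) fun j hj => hz n j hj
    have go : Measurable[pastFiltration hη.measurable c (n + 1)] (η.o n) :=
      measurable_pastFiltration hη.measurable (i := .o n) fun j hj => ho n j hj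
    have gζ : Measurable[pastFiltration hη.measurable c (n + 1)] (η.ζ n) :=
      measurable_pastFiltration hη.measurable (i := .ζ n) fun j hj => hζ n j hj
    have hX := ih.mono ((pastFiltration hη.measurable c).mono n.le_succ) le_rfl
    have hN : Measurable[pastFiltration hη.measurable c (n + 1)] (P.errorNoise η n) :=
      measurable_sumElim (gw.add ((continuous_const.matrix_mulVec
        continuous_id).measurable.comp (gz.add gζ))).neg go
    have := ((continuous_const (y := P.errorMatrix)).matrix_mulVec continuous_id).measurable.comp hX
    rw [show P.error η (n + 1) = _ from funext fun t => P.error_succ η n t]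
    exact this.add hN

variable [IsProbabilityMeasure μ]

/-- Without multiplicative part, the residual and the attack have stationary covariances. -/
theorem Plant.ae_avgCov_residual_attack (P : Plant p q m) (hK : IsSchurStable (P.A + P.B * P.K))
    (hL : IsSchurStable (P.A + P.L * P.C)) (hη : η.IsAdmissible μ SW SZ SE SO SS) :
    ∀ᵐ t ∂μ, SW.PosSemidef ∧ SZ.PosSemidef ∧ SO.PosSemidef ∧ SS.PosSemidef ∧
      AvgCov (fun n => P.residual 0 η n t) (fun n => P.residual 0 η n t)
        (P.residualMatrix * stationaryCov P.errorMatrix (P.errorNoiseCov SW SZ SO SS)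
          * P.residualMatrixᵀ + (SZ + SS)) ∧
      AvgCov (fun n => P.attack 0 η n t) (fun n => P.attack 0 η n t)
        (P.attackMatrix * stationaryCov P.errorMatrix (P.errorNoiseCov SW SZ SO SS)
          * P.attackMatrixᵀ + SS) := by
  have hst : IsStable P.errorMatrix := hL.fromBlocks hK _
  have iw : Function.Injective Source.w := fun _ _ h => Source.w.inj h
  have iz : Function.Injective Source.z := fun _ _ h => Source.z.inj h
  have io : Function.Injective Source.o := fun _ _ h => Source.o.inj h
  have iζ : Function.Injective Source.ζ := fun _ _ h => Source.ζ.inj h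
  have mw : ∀ n, Measurable[MeasurableSpace.comap (η.source (.w n)) inferInstance] (η.w n) :=
    fun n => comap_measurable (η.source (.w n))
  have mz : ∀ n, Measurable[MeasurableSpace.comap (η.source (.z n)) inferInstance] (η.z n) :=
    fun n => comap_measurable (η.source (.z n))
  have mo : ∀ n, Measurable[MeasurableSpace.comap (η.source (.o n)) inferInstance] (η.o n) :=
    fun n => comap_measurable (η.source (.o n))
  have mζ : ∀ n, Measurable[MeasurableSpace.comap (η.source (.ζ n)) inferInstance] (η.ζ n) :=
    fun n => comap_measurable (η.source (.ζ n))
  have ww := ae_avgCov_noise hη.indep iw mw hη.w_law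
  have zz := ae_avgCov_noise hη.indep iz mz hη.z_law
  have oo := ae_avgCov_noise hη.indep io mo hη.o_law
  have ζζ := ae_avgCov_noise hη.indep iζ mζ hη.ζ_law
  have wz := ae_avgCov_zero hη.measurable hη.indep iz mz hη.z_law (s := η.w)
    (fun n => measurable_pastFiltration hη.measurable (i := .w n) (by simp))
    (ww.mono fun t h => h.powerBounded)
  have wo := ae_avgCov_zero hη.measurable hη.indep io mo hη.o_law (s := η.w)
    (fun n => measurable_pastFiltration hη.measurable (i := .w n) (by simp))
    (ww.mono fun t h => h.powerBounded)
  have wζ := ae_avgCov_zero hη.measurable hη.indep iζ mζ hη.ζ_law (s := η.w)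
    (fun n => measurable_pastFiltration hη.measurable (i := .w n) (by simp))
    (ww.mono fun t h => h.powerBounded)
  have zo := ae_avgCov_zero hη.measurable hη.indep io mo hη.o_law (s := η.z)
    (fun n => measurable_pastFiltration hη.measurable (i := .z n) (by simp))
    (zz.mono fun t h => h.powerBounded)
  have zζ := ae_avgCov_zero hη.measurable hη.indep iζ mζ hη.ζ_law (s := η.z)
    (fun n => measurable_pastFiltration hη.measurable (i := .z n) (by simp))
    (zz.mono fun t h => h.powerBounded)
  have ζo := ae_avgCov_zero hη.measurable hη.indep io mo hη.o_law (s := η.ζ)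
    (fun n => measurable_pastFiltration hη.measurable (i := .ζ n) (by simp))
    (ζζ.mono fun t h => h.powerBounded)
  -- Bounded power comes pathwise from stability alone; it is needed before the law of large numbers
  -- can show that the state is uncorrelated with the noises.
  have hX : ∀ᵐ t ∂μ, PowerBounded fun n => P.error η n t := by
    filter_upwards [ww, zz, oo, ζζ] with t ww zz oo ζζ
    exact hst.powerBounded (fun n => P.error_succ η n t) (PowerBounded.elim
      (ww.powerBounded.add ((zz.powerBounded.add ζζ.powerBounded).mulVec P.L)).neg oo.powerBounded)
  have Xw := ae_avgCov_zero hη.measurable hη.indep iw mw hη.w_law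
    (P.measurable_error hη (by simp) (by simp; omega) (by simp) (by simp) (by simp)) hX
  have Xz := ae_avgCov_zero hη.measurable hη.indep iz mz hη.z_law
    (P.measurable_error hη (by simp) (by simp) (by simp; omega) (by simp) (by simp)) hX
  have Xo := ae_avgCov_zero hη.measurable hη.indep io mo hη.o_law
    (P.measurable_error hη (by simp) (by simp) (by simp) (by simp; omega) (by simp)) hX
  have Xζ := ae_avgCov_zero hη.measurable hη.indep iζ mζ hη.ζ_law
    (P.measurable_error hη (by simp) (by simp) (by simp) (by simp) (by simp; omega)) hX
  filter_upwards [ww, zz, oo, ζζ, wz, wo, wζ, zo, zζ, ζo, Xw, Xz, Xo, Xζ]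
    with t ww zz oo ζζ wz wo wζ zo zζ ζo Xw Xz Xo Xζ
  have yy := (zz.add_right zζ).add_left (zζ.swap.add_right ζζ)
  have wy := wz.add_right wζ
  have yo := zo.add_left ζo
  have Xy := Xz.add_right Xζ
  have nn := ((ww.add_right (wy.mulVec_right P.L)).add_left
    ((wy.swap.mulVec_left P.L).add_right ((yy.mulVec_right P.L).mulVec_left P.L))).neg_left.neg_right
  have no := (wo.add_left (yo.mulVec_left P.L)).neg_left
  have Xn := ((Xw.add_right (Xy.mulVec_right P.L)).neg_right).elim_right Xo
  have NN := (nn.elim_right no).elim_left (no.swap.elim_right oo)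
  have XX : AvgCov (fun n => P.error η n t) (fun n => P.error η n t)
      (stationaryCov P.errorMatrix (P.errorNoiseCov SW SZ SO SS)) := by
    refine hst.avgCov (η := fun n => P.errorNoise η n t) (fun n => P.error_succ η n t) ?_ ?_
    · refine NN.of_eq ?_
      ext (i | i) (j | j) <;> simp [Plant.errorNoiseCov, Matrix.mul_assoc]
    · refine Xn.of_eq ?_
      ext i (j | j) <;> simp
  refine ⟨ww.posSemidef, zz.posSemidef, oo.posSemidef, ζζ.posSemidef, ?_, ?_⟩
  · simp only [P.residual_zero_eq]
    have hXy := (Xy.mulVec_left P.residualMatrix).neg_right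
    have := (((XX.mulVec_left P.residualMatrix).mulVec_right _).add_right hXy).add_left
      (hXy.swap.add_right yy.neg_left.neg_right)
    exact this.of_eq (by simp)
  · simp only [P.attack_zero_eq]
    have hXζ := Xζ.mulVec_left P.attackMatrix
    have := (((XX.mulVec_left P.attackMatrix).mulVec_right _).add_right hXζ).add_left
      (hXζ.swap.add_right ζζ)
    exact this.of_eq (by simp)

end Admissible

end Watermark

/-! ### The main theorem. -/

theorem mainTheorem2 {p q m : ℕ} (hp : 0 < p) (P : Watermark.Plant p q m)
    (hctrl : Watermark.IsControllable P.A P.B)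
    (hobs : Watermark.IsObservable P.A P.C)
    (hK : Watermark.IsSchurStable (P.A + P.B * P.K))
    (hL : Watermark.IsSchurStable (P.A + P.L * P.C)) :
    ∃ k' : ℕ, IsLeast {k : ℕ | P.C * (P.A + P.B * P.K) ^ k * P.B ≠ 0} k' ∧ k' ≤ p - 1 ∧
      ∀ (Ω : Type*) [MeasurableSpace Ω] (μ : Measure Ω) [IsProbabilityMeasure μ]
        (SW : Matrix (Fin p) (Fin p) ℝ) (SZ : Matrix (Fin m) (Fin m) ℝ)
        (SE : Matrix (Fin q) (Fin q) ℝ) (SO : Matrix (Fin p) (Fin p) ℝ)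
        (SS : Matrix (Fin m) (Fin m) ℝ) (α : ℝ) (η : Watermark.Inputs p q m Ω),
        η.IsAdmissible μ SW SZ SE SO SS → SE.rank = q →
        P.PassesTests μ α η SW SZ k' →
        Watermark.AvgTendsto μ (fun n t => P.attack α η n t ⬝ᵥ P.attack α η n t) 0 := by
  classical
  obtain ⟨k, hkp, hk⟩ := Watermark.exists_markov_ne_zero hp P hctrl hobs
  have hex : ∃ k, P.C * (P.A + P.B * P.K) ^ k * P.B ≠ 0 := ⟨k, hk⟩
  have hleast : IsLeast {k : ℕ | P.C * (P.A + P.B * P.K) ^ k * P.B ≠ 0} (Nat.find hex) :=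
    ⟨Nat.find_spec hex, fun j hj => Nat.find_min' hex hj⟩
  refine ⟨Nat.find hex, hleast, by have := Nat.find_min' hex hk; omega, ?_⟩
  intro Ω _ μ _ SW SZ SE SO SS α η hη hSE htest
  obtain rfl := htest.gain_eq_zero hη hSE hleast
  filter_upwards [P.ae_avgCov_residual_attack hK hL hη, htest.1.avgCov] with t ht hr
  obtain ⟨hSW, hSZ, hSO, hSS, hres, hatt⟩ := ht
  -- On one path the residual averages have two limits, the stationary one and the tested one;
  -- equating them gives the covariance identity. The average power of the attack is then the trace
  -- of its zero covariance.
  rw [P.attackCov_eq_zero hK hL hSW hSZ hSO hSS (hres.unique hr)] at hatt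
  have := tendsto_finsetSum Finset.univ fun i (_ : i ∈ Finset.univ) => hatt i i
  simp only [Matrix.zero_apply, Finset.sum_const_zero] at this
  refine this.congr fun N => ?_
  rw [← Finset.mul_sum, Finset.sum_comm, smul_eq_mul]
  rfl
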